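/- Let $n\ge 0$ and let $r_1\le r_2\le\cdots\le r_n\le n$ be integers with $r_k\ge k$ for all $k$. Let $(h_1,\dots,h_n)$ be the sequence of heights of the rises of the Dyck path $D(\mathbf r)$ whose $k$-th fall is preceded by exactly $r_k$ rises, so that $h_i=i-|\{k: r_k<i\}|$, and let $[m]_q=1+q+\cdots+q^{m-1}$. Let $D_n$ be the set of signed permutations $\sigma$ of $\{\pm1,\dots,\pm n\}$ (with $\sigma(-k)=-\sigma(k)$) such that an even number of $\sigma(1),\dots,\sigma(n)$ are negative, and let $D_n(\mathbf r)=\{\sigma\in D_n: |\sigma(k)|\le r_k,\ 1\le k\le n\}$. For $\sigma\in D_n$ put $$\mathrm{inv}_D(\sigma)=|\{i<j:\sigma(i)>\sigma(j)\}|+|\{i<j:-\sigma(i)>\sigma(j)\}|,$$ $$\mathrm{Prlminl}'(\sigma)=\{\sigma(k): 1<\sigma(k)<|\sigma(l)|\text{ for all } l>k\}$$ (all indices between $1$ and $n$). Let $\mathrm{Cyc}'_0(\sigma)$ (respectively $\mathrm{Cyc}'_1(\sigma)$) be the set of the minimal absolute values of the elements of the balanced (respectively unbalanced) cycles of $\sigma$,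 with $1$ removed; a cycle is unbalanced if it contains $-a$ along with each of its elements $a$, and balanced otherwise. The type $D$ sorting index is $\mathrm{sor}_D(\sigma)=\sum_{s}\left(j_s-i_s-2\chi(i_s<0)\right)$, where $\sigma=(i_1\,j_1)\cdots(i_k\,j_k)$ is the unique factorization with $1<j_1<\cdots<j_k\le n$, $i_s\ne 0$ and $-j_s\le i_s<j_s$. Here $(i\,j)$ with $i\neq -j$ swaps $i$ with $j$ and $-i$ with $-j$, and $(-j\;\,j)$ changes the signs of both $1$ and $j$. For $\sigma,\sigma_0\in D_n(\mathbf r)$ with $\sigma_0(k)>0$ for all $k\ge1$, the sorting index $\mathrm{sor}_{D,\mathbf r}(\sigma,\sigma_0)=\sum_{k=2}^n b_k$ relative to $\sigma_0$ is defined by sorting: put $\sigma_n=\sigma$ and, for $k=n,n-1,\dots,2$, let $l=\sigma_k^{-1}(k)$, $m=\sigma_0^{-1}(k)$, and let $\sigma_{k-1}$ be obtained from $\sigma_k$ by exchanging the entries in positions $l$ and $m$ (and those in positions $-l$ and $-m$). Let $$a_k=\begin{cases}|\{i\in[1,n]: |l|\le i\le m,\ \sigma_0(i)<k\}|, & |l|\le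 m,\\ |\{i\in[1,n]: r_i\ge k,\ i\notin(m,|l|),\ \sigma_0(i)<k\}|, & |l|>m,\end{cases}$$ and let $b_k=a_k$ if $l>0$ and $b_k=2k-2-a_k$ if $l<0$. Then, for a commuting variable $q$ and commuting variables $t_i,s_i$: (1) $$\sum_{\sigma\in D_n(\mathbf r)}q^{\mathrm{inv}_D(\sigma)}\prod_{i\in\mathrm{Prlminl}'(\sigma)}t_i=\prod_{i=2}^n\left(t_i+q[h_i-1]_q+q^{2i-h_i-1}[h_i]_q\right).$$ (2) For every $\sigma_0\in D_n(\mathbf r)$ with $\sigma_0(k)>0$ for all $k\ge1$, $$\sum_{\sigma\in D_n(\mathbf r)}q^{\mathrm{sor}_{D,\mathbf r}(\sigma,\sigma_0)}\prod_{i\in\mathrm{Cyc}'_0(\sigma\sigma_0^{-1})}t_i\prod_{i\in\mathrm{Cyc}'_1(\sigma\sigma_0^{-1})}s_i=\prod_{i=2}^n\left(t_i+(q+q^{2i-h_i-1})[h_i-1]_q+q^{2i-2}s_i\right),$$ and $$\sum_{\sigma\in D_n(\mathbf r)}q^{\mathrm{sor}_{D,\mathbf r}(\sigma,\sigma_0)}\prod_{i\in\mathrm{Cyc}'_0(\sigma\sigma_0^{-1})}t_i=\sum_{\sigma\in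 D_n(\mathbf r)}q^{\mathrm{inv}_D(\sigma)}\prod_{i\in\mathrm{Prlminl}'(\sigma)}t_i,$$ that is, the multisets $\{(\mathrm{sor}_{D,\mathbf r}(\sigma,\sigma_0),\mathrm{Cyc}'_0(\sigma\sigma_0^{-1})):\sigma\in D_n(\mathbf r)\}$ and $\{(\mathrm{inv}_D(\sigma),\mathrm{Prlminl}'(\sigma)):\sigma\in D_n(\mathbf r)\}$ are equal. (3) For $\sigma\in D_n(\mathbf r)$ one has $\mathrm{sor}_{D,\mathbf r}(\sigma,\mathrm{id})=\mathrm{sor}_D(\sigma)$. Hence $$\sum_{\sigma\in D_n(\mathbf r)}q^{\mathrm{sor}_D(\sigma)}\prod_{i\in\mathrm{Cyc}'_0(\sigma)}t_i\prod_{i\in\mathrm{Cyc}'_1(\sigma)}s_i=\prod_{i=2}^n\left(t_i+(q+q^{2i-h_i-1})[h_i-1]_q+q^{2i-2}s_i\right),$$ $$\sum_{\sigma\in D_n(\mathbf r)}q^{\mathrm{sor}_D(\sigma)}\prod_{i\in\mathrm{Cyc}'_0(\sigma)}t_i=\sum_{\sigma\in D_n(\mathbf r)}q^{\mathrm{inv}_D(\sigma)}\prod_{i\in\mathrm{Prlminl}'(\sigma)}t_i,$$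 and the pairs $(\mathrm{sor}_D,\mathrm{Cyc}'_0)$ and $(\mathrm{inv}_D,\mathrm{Prlminl}')$ are equidistributed on $D_n(\mathbf r)$. -/

import Mathlib

namespace RestrictedD

open Equiv (Perm)

/-- Signed permutations of size `n`: bijections of `ℤ` that commute with negation and fix every
integer outside `[-n, n]`. The `k`-th entry of the one-line word of `σ` is `σ k`, and the product
of signed permutations is composition. -/
def typeB (n : ℕ) : Set (Perm ℤ) :=
  {σ | (∀ x : ℤ, σ (-x) = -σ x) ∧ ∀ x : ℤ, (n : ℤ) < |x| → σ x = x}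

/-- The number of minus signs in the word `σ 1, …, σ n`. -/
def negCount (n : ℕ) (σ : Perm ℤ) : ℕ :=
  ((Finset.Icc 1 n).filter (fun k : ℕ => σ (k : ℤ) < 0)).card

/-- Type `D` permutations: signed permutations with an even number of minus signs. -/
def typeD (n : ℕ) : Set (Perm ℤ) :=
  {σ | σ ∈ typeB n ∧ Even (negCount n σ)}

theorem typeB_finite (n : ℕ) : (typeB n).Finite := by
  refine (Set.finite_range
    (Perm.ofSubtype : Perm {x : ℤ // x ∈ Finset.Icc (-(n : ℤ)) n} →* Perm ℤ)).subset ?_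
  rintro σ ⟨-, hfix⟩
  have hout : ∀ x : ℤ, x ∉ Finset.Icc (-(n : ℤ)) n → σ x = x := by
    intro x hx
    apply hfix
    rw [Finset.mem_Icc, ← abs_le] at hx
    exact not_le.mp hx
  have hiff : ∀ x : ℤ, σ x ∈ Finset.Icc (-(n : ℤ)) n ↔ x ∈ Finset.Icc (-(n : ℤ)) n := by
    intro x
    constructor
    · intro h
      by_contra hx
      rw [hout x hx] at h
      exact hx h
    · intro h
      by_contra hx
      have h2 := σ.injective (hout (σ x) hx)
      rw [h2] at hx
      exact hx h
  refine ⟨σ.subtypePerm hiff, ?_⟩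
  apply Perm.ofSubtype_subtypePerm
  intro x hx
  by_contra hc
  exact hx (hout x hc)

/-- The restricted type `D` permutations `D_n(r)`, as a set. -/
def restrictedDSet (n : ℕ) (r : ℕ → ℕ) : Set (Perm ℤ) :=
  {σ | σ ∈ typeD n ∧ ∀ k : ℕ, k ∈ Finset.Icc 1 n → |σ (k : ℤ)| ≤ (r k : ℤ)}

theorem restrictedDSet_finite (n : ℕ) (r : ℕ → ℕ) : (restrictedDSet n r).Finite :=
  (typeB_finite n).subset (fun _ h => h.1.1)

/-- The restricted type `D` permutations `D_n(r)`, as a finite set. -/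
noncomputable def restrictedD (n : ℕ) (r : ℕ → ℕ) : Finset (Perm ℤ) :=
  (restrictedDSet_finite n r).toFinset

/-- The height of the `i`-th rise of the Dyck path whose `k`-th fall (`1 ≤ k ≤ n`) is preceded by
exactly `r k` rises: the `i` rises up to and including this one, minus the falls before it. -/
def riseHeight (n : ℕ) (r : ℕ → ℕ) (i : ℕ) : ℕ :=
  i - ((Finset.Icc 1 n).filter (fun k => r k < i)).card

/-- The `q`-integer `[m]_q = 1 + q + ⋯ + q ^ (m - 1)`. -/
def qInt {R : Type*} [CommSemiring R] (q : R) (m : ℕ) : R := ∑ i ∈ Finset.range m, q ^ i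

/-- The type `D` inversion number. -/
def invD (n : ℕ) (σ : Perm ℤ) : ℕ :=
  ((Finset.Icc 1 n ×ˢ Finset.Icc 1 n).filter
      (fun p : ℕ × ℕ => p.1 < p.2 ∧ σ (p.1 : ℤ) > σ (p.2 : ℤ))).card +
  ((Finset.Icc 1 n ×ˢ Finset.Icc 1 n).filter
      (fun p : ℕ × ℕ => p.1 < p.2 ∧ -σ (p.1 : ℤ) > σ (p.2 : ℤ))).card

/-- The set of letters `σ k` with `1 < σ k < |σ l|` for all `l > k`. -/
def prlminl' (n : ℕ) (σ : Perm ℤ) : Finset ℕ :=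
  ((Finset.Icc 1 n).filter (fun k : ℕ =>
      1 < σ (k : ℤ) ∧ ∀ l ∈ Finset.Ioc k n, σ (k : ℤ) < |σ (l : ℤ)|)).image
    (fun k : ℕ => (σ (k : ℤ)).toNat)

open Classical in
/-- Minimal absolute values of the elements of the balanced cycles of `σ`
(a cycle through `k` is unbalanced when it also contains `-k`). -/
noncomputable def cyc0 (n : ℕ) (σ : Perm ℤ) : Finset ℕ :=
  (Finset.Icc 1 n).filter (fun k : ℕ =>
    (∀ m : ℤ, σ.SameCycle (k : ℤ) m → (k : ℤ) ≤ |m|) ∧ ¬ σ.SameCycle (k : ℤ) (-(k : ℤ)))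

open Classical in
/-- Minimal absolute values of the elements of the unbalanced cycles of `σ`. -/
noncomputable def cyc1 (n : ℕ) (σ : Perm ℤ) : Finset ℕ :=
  (Finset.Icc 1 n).filter (fun k : ℕ =>
    (∀ m : ℤ, σ.SameCycle (k : ℤ) m → (k : ℤ) ≤ |m|) ∧ σ.SameCycle (k : ℤ) (-(k : ℤ)))

noncomputable def cyc0' (n : ℕ) (σ : Perm ℤ) : Finset ℕ := (cyc0 n σ).erase 1

noncomputable def cyc1' (n : ℕ) (σ : Perm ℤ) : Finset ℕ := (cyc1 n σ).erase 1

/-- The signed transposition `(i j)`: it swaps `i` with `j` and `-i` with `-j`. For `i = -j` it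
just swaps `j` with `-j`, and for `i = j` it is the identity. -/
def signedSwap (i j : ℤ) : Perm ℤ :=
  if i = -j then Equiv.swap i j else Equiv.swap i j * Equiv.swap (-i) (-j)

/-- The transposition `(i j)` in type `D`. As the sign change of `j` alone is not of type `D`, for
`i = -j` it changes the signs of both `1` and `j`. -/
def dTransposition (i j : ℤ) : Perm ℤ :=
  if i = -j then signedSwap (-1) 1 * signedSwap (-j) j else signedSwap i j

/-- `L = [(i₁, j₁), …, (i_k, j_k)]` is a factorization `σ = (i₁ j₁) ⋯ (i_k j_k)` into type `D`
transpositions with `1 < j₁ < ⋯ < j_k ≤ n` and `i_s ∈ {±1, …, ±j_s}`, `i_s < j_s`. -/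
def IsSortingFactorization (n : ℕ) (σ : Perm ℤ) (L : List (ℤ × ℤ)) : Prop :=
  (∀ p ∈ L, 1 < p.2 ∧ p.2 ≤ (n : ℤ) ∧ p.1 ≠ 0 ∧ -p.2 ≤ p.1 ∧ p.1 < p.2) ∧
  L.Pairwise (fun p p' => p.2 < p'.2) ∧
  (L.map (fun p => dTransposition p.1 p.2)).prod = σ

open Classical in
/-- The type `D` sorting index `∑ (j_s - i_s - 2 χ(i_s < 0))`, read off from the (unique) sorting
factorization of `σ`. -/
noncomputable def sorD (n : ℕ) (σ : Perm ℤ) : ℕ :=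
  if h : ∃ L, IsSortingFactorization n σ L then
    (h.choose.map (fun p => (p.2 - p.1 - (if p.1 < 0 then 2 else 0)).toNat)).sum
  else 0

/-- The contribution of the letter `k` to the sorting index relative to `σ₀` (a word with positive
entries). Here `l` and `m` are the positions of `k` in the current word `σ` and in `σ₀`. The first
count is over the positions from `|l|` to `m`. The second is over the positions met when moving
from `|l|` to `m` cyclically, that is to the right and around, among those with `k ≤ r i`. -/
def relSorTerm (n : ℕ) (r : ℕ → ℕ) (σ₀ : Perm ℤ) (k : ℕ) (σ : Perm ℤ) : ℕ :=
  let l : ℤ := σ⁻¹ (k : ℤ)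
  let m : ℤ := σ₀⁻¹ (k : ℤ)
  let a : ℕ :=
    if |l| ≤ m then
      ((Finset.Icc 1 n).filter (fun i : ℕ =>
        |l| ≤ (i : ℤ) ∧ (i : ℤ) ≤ m ∧ σ₀ (i : ℤ) < (k : ℤ))).card
    else
      ((Finset.Icc 1 n).filter (fun i : ℕ =>
        k ≤ r i ∧ ¬(m < (i : ℤ) ∧ (i : ℤ) < |l|) ∧ σ₀ (i : ℤ) < (k : ℤ))).card
  if 0 < l then a else 2 * k - 2 - a

/-- Sort the letters `k, k - 1, …, 2` of `σ` in this order, each time moving the letter to the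
position it has in `σ₀` by a signed transposition of positions, and add up the contributions. -/
def relSorAux (n : ℕ) (r : ℕ → ℕ) (σ₀ : Perm ℤ) : ℕ → Perm ℤ → ℕ
  | 0, _ => 0
  | 1, _ => 0
  | k + 2, σ => relSorTerm n r σ₀ (k + 2) σ +
      relSorAux n r σ₀ (k + 1)
        (σ * signedSwap (σ⁻¹ ((k + 2 : ℕ) : ℤ)) (σ₀⁻¹ ((k + 2 : ℕ) : ℤ)))

/-- The type `D` sorting index of `σ` relative to `σ₀` on `D_n(r)`. -/
def relSorD (n : ℕ) (r : ℕ → ℕ) (σ σ₀ : Perm ℤ) : ℕ := relSorAux n r σ₀ n σ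

end RestrictedD

namespace RestrictedD

open Equiv (Perm)

/-! The argument runs over all signed permutations bounded by `r` and restricts to type D at the
end. A word is unravelled letter by letter: `stage n r σ₀ k` holds the words in which only the
letters up to `k` may still differ in place from `σ₀`. Recording the signed position `l` of `k + 1`
and then bringing that letter home by a permutation `g l` of positions is a bijection from stage `k
+ 1` to pairs (signed slot, word of stage `k`). There are `riseHeight n r (k + 1)` slots up to sign,
whatever `σ₀` is (`card_slots`). A weight that gains a factor depending only on `l` at each stage
therefore has a product as its generating function (`sum_stage_eq_prod`).

Two families of moves are used. For the sorting index, `g l` is the signed transposition of `l` with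
the place of the letter. The term `b_k` is then the cyclic rank of the slot, or `2k - 2` minus it
for negative `l`, and `k` is inserted into a cycle of `σ * σ₀⁻¹`, becoming a new minimum only at
rank 0. For inversions, with `σ₀ = 1`, `g l` is a shift, so that `±k` is inserted into a shorter
word. It creates `k - |l|` or `2k - 2 - (k - |l|)` inversions, and `k` joins `prlminl'` only when `l
= k`. The ranks are `0, …, h - 1` in both cases, so both sums reduce to sums of powers of `q`.

Changing the sign of the letter `1` alters none of the statistics (which is why `1` is left out of
the letter sets) but changes the parity of the minus signs. Hence the sum over bounded signed words
is twice the sum over type D, and the last stage has exactly two words. The factor 2 is cancelled in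
polynomials over `ℕ`, and the identity is then specialized to `R`. Setting `s = 1` makes the two
products agree, and reading off coefficients gives equality of multisets.

For `σ₀ = 1` the sorting procedure peels the factors off a sorting factorization from the right. The
extra sign change of `1` in `(-j j)` is harmless, because positions `1` and `-1` contribute the same
`k - 1`. -/

/-! ### The group of signed permutations. -/

theorem apply_inv_self (σ : Perm ℤ) (x : ℤ) : σ (σ⁻¹ x) = x := σ.apply_symm_apply x

theorem inv_apply_self (σ : Perm ℤ) (x : ℤ) : σ⁻¹ (σ x) = x := σ.symm_apply_apply x

theorem typeB_one (n : ℕ) : (1 : Perm ℤ) ∈ typeB n := ⟨fun _ => rfl, fun _ _ => rfl⟩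

theorem typeB_mul {n : ℕ} {σ τ : Perm ℤ} (hσ : σ ∈ typeB n) (hτ : τ ∈ typeB n) :
    σ * τ ∈ typeB n := by
  refine ⟨fun x => ?_, fun x hx => ?_⟩
  · rw [Perm.mul_apply, Perm.mul_apply, hτ.1, hσ.1]
  · rw [Perm.mul_apply, hτ.2 x hx, hσ.2 x hx]

theorem typeB_inv {n : ℕ} {σ : Perm ℤ} (hσ : σ ∈ typeB n) : σ⁻¹ ∈ typeB n := by
  refine ⟨fun x => ?_, fun x hx => ?_⟩
  · rw [Perm.inv_eq_iff_eq, hσ.1, apply_inv_self]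
  · rw [Perm.inv_eq_iff_eq, hσ.2 x hx]

theorem typeB_zero {n : ℕ} {σ : Perm ℤ} (hσ : σ ∈ typeB n) : σ 0 = 0 := by
  have := hσ.1 0
  simp only [neg_zero] at this
  omega

theorem typeB_ne_zero {n : ℕ} {σ : Perm ℤ} (hσ : σ ∈ typeB n) {x : ℤ} (hx : x ≠ 0) :
    σ x ≠ 0 := by
  intro h
  exact hx (σ.injective (h.trans (typeB_zero hσ).symm))

theorem typeB_abs_le {n : ℕ} {σ : Perm ℤ} (hσ : σ ∈ typeB n) {x : ℤ} (hx : |x| ≤ n) :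
    |σ x| ≤ n := by
  by_contra h
  have h1 := hσ.2 _ (not_le.mp h)
  rw [σ.injective h1] at h
  exact h hx

theorem typeB_apply_abs {n : ℕ} {σ : Perm ℤ} (hσ : σ ∈ typeB n) (x : ℤ) :
    |σ (|x|)| = |σ x| := by
  rcases abs_choice x with h | h <;> rw [h]
  rw [hσ.1, abs_neg]

/-! ### Stages, moves and the factorization of sums. -/

/-- Signed permutations bounded by `r` whose letters beyond `k` are placed as in `σ₀`. -/
def stage (n : ℕ) (r : ℕ → ℕ) (σ₀ : Perm ℤ) (k : ℕ) : Set (Perm ℤ) :=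
  {σ | σ ∈ typeB n ∧ (∀ i : ℕ, i ∈ Finset.Icc 1 n → |σ (i : ℤ)| ≤ (r i : ℤ)) ∧
    ∀ j : ℤ, (k : ℤ) < |j| → σ⁻¹ j = σ₀⁻¹ j}

noncomputable def stageFinset (n : ℕ) (r : ℕ → ℕ) (σ₀ : Perm ℤ) (k : ℕ) : Finset (Perm ℤ) :=
  ((typeB_finite n).subset (fun _ h => h.1) : (stage n r σ₀ k).Finite).toFinset

theorem mem_stageFinset {n : ℕ} {r : ℕ → ℕ} {σ₀ σ : Perm ℤ} {k : ℕ} :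
    σ ∈ stageFinset n r σ₀ k ↔ σ ∈ stage n r σ₀ k := by
  simp [stageFinset]

/-- The permutation `g` of positions moves the place of `k` in `σ₀` to `l`, in a way that respects
the places of the letters beyond `k` and the bounds `r`. -/
structure IsMove (n : ℕ) (r : ℕ → ℕ) (σ₀ : Perm ℤ) (k : ℕ) (l : ℤ) (g : Perm ℤ) : Prop where
  mem : g ∈ typeB n
  map : g (σ₀⁻¹ (k : ℤ)) = l
  fix : ∀ j : ℤ, (k : ℤ) < |j| → g (σ₀⁻¹ j) = σ₀⁻¹ j
  bound : ∀ i : ℕ, i ∈ Finset.Icc 1 n → g (i : ℤ) ≠ i → k ≤ r i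

theorem IsMove.mul_mem {n : ℕ} {r : ℕ → ℕ} {σ₀ : Perm ℤ} {k : ℕ} {g σ : Perm ℤ}
    (h₀ : σ₀ ∈ typeB n) (hσ : σ ∈ stage n r σ₀ (k + 1))
    (hg : IsMove n r σ₀ (k + 1) (σ⁻¹ ((k + 1 : ℕ) : ℤ)) g) : σ * g ∈ stage n r σ₀ k := by
  obtain ⟨hB, hb, hf⟩ := hσ
  have key : ∀ j : ℤ, (k : ℤ) < |j| → (σ * g)⁻¹ j = σ₀⁻¹ j := by
    intro j hj
    rw [mul_inv_rev, Perm.mul_apply, Perm.inv_eq_iff_eq]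
    rcases lt_or_eq_of_le (show ((k + 1 : ℕ) : ℤ) ≤ |j| by push_cast; omega) with h | h
    · rw [hf j h, hg.fix j h]
    · rcases abs_choice j with h' | h'
      · rw [← h'.symm.trans h.symm |>.symm, hg.map]
      · have : j = -((k + 1 : ℕ) : ℤ) := by omega
        rw [this, (typeB_inv hB).1, (typeB_inv h₀).1, hg.mem.1, hg.map]
  refine ⟨typeB_mul hB hg.mem, fun i hi => ?_, key⟩
  rw [Perm.mul_apply]
  by_cases hgi : g (i : ℤ) = i
  · rw [hgi]; exact hb i hi
  -- A letter exceeding `r i` would be beyond `k + 1`, hence already at its place in `σ₀`, which `g`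
  -- fixes. Then `g (g i) = g i`, against `g i ≠ i`.
  · by_contra hlt
    have hk : ((k + 1 : ℕ) : ℤ) ≤ r i := by exact_mod_cast hg.bound i hi hgi
    have h1 := hf (σ (g i)) (by omega)
    have h2 := hg.fix (σ (g i)) (by omega)
    rw [← h1, inv_apply_self] at h2
    exact hgi (g.injective h2)

/-- The inverse of `IsMove.mul_mem`: undoing the move returns to the previous stage, and the
position `l` of the letter can be recovered there. -/
theorem IsMove.mul_inv_mem {n : ℕ} {r : ℕ → ℕ} {σ₀ : Perm ℤ} {k : ℕ} {l : ℤ} {g σ : Perm ℤ}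
    (hσ : σ ∈ stage n r σ₀ k) (hg : IsMove n r σ₀ (k + 1) l g) :
    σ * g⁻¹ ∈ stage n r σ₀ (k + 1) ∧ (σ * g⁻¹)⁻¹ ((k + 1 : ℕ) : ℤ) = l := by
  obtain ⟨hB, hb, hf⟩ := hσ
  refine ⟨⟨typeB_mul hB (typeB_inv hg.mem), fun i hi => ?_, fun j hj => ?_⟩, ?_⟩
  · rw [Perm.mul_apply]
    by_cases hgi : g (i : ℤ) = i
    · rw [Perm.inv_eq_iff_eq.mpr hgi.symm]; exact hb i hi
    · by_contra hlt
      have hk : ((k + 1 : ℕ) : ℤ) ≤ r i := by exact_mod_cast hg.bound i hi hgi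
      have h1 := hf (σ (g⁻¹ i)) (by omega)
      have h2 := hg.fix (σ (g⁻¹ i)) (by omega)
      rw [← h1, inv_apply_self, apply_inv_self] at h2
      exact hgi (Perm.inv_eq_iff_eq.mp h2.symm).symm
  · rw [mul_inv_rev, Perm.mul_apply, inv_inv, hf j (by push_cast at hj; omega), hg.fix j hj]
  · rw [mul_inv_rev, Perm.mul_apply, inv_inv, hf _ (by push_cast; rw [abs_of_pos] <;> omega),
      hg.map]

/-- The positions at which the letter `k` may occur in a word of `stage n r σ₀ k`. -/
def slots (n : ℕ) (r : ℕ → ℕ) (σ₀ : Perm ℤ) (k : ℕ) : Finset ℕ :=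
  (Finset.Icc 1 n).filter (fun i => k ≤ r i ∧ σ₀ (i : ℤ) ≤ k)

theorem mem_slots {n : ℕ} {r : ℕ → ℕ} {σ₀ : Perm ℤ} {k i : ℕ} :
    i ∈ slots n r σ₀ k ↔ (1 ≤ i ∧ i ≤ n) ∧ k ≤ r i ∧ σ₀ (i : ℤ) ≤ k := by
  simp [slots]

theorem natAbs_mem_slots {n : ℕ} {r : ℕ → ℕ} {σ₀ σ : Perm ℤ} {k : ℕ} (hk : 1 ≤ k) (hkn : k ≤ n)
    (hσ : σ ∈ stage n r σ₀ k) : (σ⁻¹ (k : ℤ)).natAbs ∈ slots n r σ₀ k := by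
  obtain ⟨hB, hb, hf⟩ := hσ
  set l := σ⁻¹ (k : ℤ) with hl
  have hl0 : l ≠ 0 := typeB_ne_zero (typeB_inv hB) (by omega)
  have hln : |l| ≤ n := typeB_abs_le (typeB_inv hB) (by rw [abs_of_nonneg] <;> omega)
  have habs : |σ (l.natAbs : ℤ)| = k := by
    rw [Int.natCast_natAbs, typeB_apply_abs hB, hl, apply_inv_self]
    simp
  have hI : 1 ≤ l.natAbs ∧ l.natAbs ≤ n := by rw [Int.abs_eq_natAbs] at hln; omega
  rw [mem_slots]
  refine ⟨hI, ?_, ?_⟩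
  · have := hb l.natAbs (Finset.mem_Icc.mpr hI)
    omega
  -- Otherwise `|l|` is the place of a letter beyond `k`, and that letter is frozen there.
  · by_contra hlt
    have := hf (σ₀ l.natAbs) (by rw [abs_of_pos] <;> omega)
    rw [inv_apply_self, Perm.inv_eq_iff_eq] at this
    rw [← this] at habs
    rw [abs_of_pos (by omega)] at habs
    omega

theorem sum_stage_succ {M : Type*} [AddCommMonoid M] {n : ℕ} {r : ℕ → ℕ} {σ₀ : Perm ℤ} {k : ℕ}
    (h₀ : σ₀ ∈ typeB n) (hkn : k + 1 ≤ n) (g : ℤ → Perm ℤ)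
    (hg : ∀ l : ℤ, l.natAbs ∈ slots n r σ₀ (k + 1) → IsMove n r σ₀ (k + 1) l (g l))
    (F : Perm ℤ → M) :
    ∑ σ ∈ stageFinset n r σ₀ (k + 1), F σ =
      ∑ i ∈ slots n r σ₀ (k + 1), ((∑ σ ∈ stageFinset n r σ₀ k, F (σ * (g i)⁻¹)) +
        ∑ σ ∈ stageFinset n r σ₀ k, F (σ * (g (-i))⁻¹)) := by
  classical
  set S := slots n r σ₀ (k + 1) with hS
  have hpos : ∀ i ∈ S, 1 ≤ i := fun i hi => (mem_slots.mp hi).1.1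
  have hdisj : Disjoint (S.image (fun i : ℕ => (i : ℤ))) (S.image (fun i : ℕ => -(i : ℤ))) := by
    rw [Finset.disjoint_left]
    intro x hx hx'
    obtain ⟨i, hi, rfl⟩ := Finset.mem_image.mp hx
    obtain ⟨j, hj, hij⟩ := Finset.mem_image.mp hx'
    have := hpos i hi
    have := hpos j hj
    omega
  have hmem : ∀ l : ℤ, l ∈ S.image (fun i : ℕ => (i : ℤ)) ∪ S.image (fun i : ℕ => -(i : ℤ)) ↔
      l.natAbs ∈ S := by
    intro l
    simp only [Finset.mem_union, Finset.mem_image]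
    constructor
    · rintro (⟨i, hi, rfl⟩ | ⟨i, hi, rfl⟩) <;> simpa using hi
    · intro h
      rcases Int.natAbs_eq l with h' | h'
      · exact Or.inl ⟨_, h, h'.symm⟩
      · exact Or.inr ⟨_, h, h'.symm⟩
  have hsum : ∑ i ∈ S, ((∑ σ ∈ stageFinset n r σ₀ k, F (σ * (g i)⁻¹)) +
        ∑ σ ∈ stageFinset n r σ₀ k, F (σ * (g (-i))⁻¹)) =
      ∑ l ∈ S.image (fun i : ℕ => (i : ℤ)) ∪ S.image (fun i : ℕ => -(i : ℤ)),
        ∑ σ ∈ stageFinset n r σ₀ k, F (σ * (g l)⁻¹) := by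
    rw [Finset.sum_union hdisj, Finset.sum_add_distrib, Finset.sum_image, Finset.sum_image]
    · intro a _ b _ h
      simpa using h
    · intro a _ b _ h
      simpa using h
  rw [hsum, ← Finset.sum_product']
  -- The bijection with pairs: the signed position of `k + 1`, and the word after that letter has
  -- been brought home.
  refine Finset.sum_nbij' (fun σ => (σ⁻¹ ((k + 1 : ℕ) : ℤ), σ * g (σ⁻¹ ((k + 1 : ℕ) : ℤ))))
    (fun p => p.2 * (g p.1)⁻¹) ?_ ?_ ?_ ?_ ?_
  · intro σ hσ
    rw [mem_stageFinset] at hσ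
    have h1 := natAbs_mem_slots (by omega) hkn hσ
    rw [Finset.mem_product, mem_stageFinset, hmem]
    exact ⟨h1, IsMove.mul_mem h₀ hσ (hg _ h1)⟩
  · rintro ⟨l, σ⟩ hp
    rw [Finset.mem_product, mem_stageFinset, hmem] at hp
    rw [mem_stageFinset]
    exact (IsMove.mul_inv_mem hp.2 (hg l hp.1)).1
  · intro σ _
    simp
  · rintro ⟨l, σ⟩ hp
    rw [Finset.mem_product, mem_stageFinset, hmem] at hp
    have := (IsMove.mul_inv_mem hp.2 (hg l hp.1)).2
    simp only [this]
    simp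
  · intro σ _
    simp

/-- The generating function of a weight that factors along the stages. -/
theorem sum_stage_eq_prod {R : Type*} [CommSemiring R] {n : ℕ} {r : ℕ → ℕ} {σ₀ : Perm ℤ}
    (h₀ : σ₀ ∈ typeB n) (g : ℕ → ℤ → Perm ℤ) (F : ℕ → Perm ℤ → R) (w : ℕ → ℤ → R)
    (hg : ∀ k, 2 ≤ k → k ≤ n → ∀ l : ℤ, l.natAbs ∈ slots n r σ₀ k → IsMove n r σ₀ k l (g k l))
    (hF : ∀ k, 1 ≤ k → k + 1 ≤ n → ∀ l : ℤ, l.natAbs ∈ slots n r σ₀ (k + 1) →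
      ∀ σ ∈ stage n r σ₀ k, F (k + 1) (σ * (g (k + 1) l)⁻¹) = w (k + 1) l * F k σ)
    (k : ℕ) (hk : 1 ≤ k) (hkn : k ≤ n) :
    ∑ σ ∈ stageFinset n r σ₀ k, F k σ =
      (∏ i ∈ Finset.Icc 2 k, ∑ p ∈ slots n r σ₀ i, (w i p + w i (-p))) *
        ∑ σ ∈ stageFinset n r σ₀ 1, F 1 σ := by
  induction k, hk using Nat.le_induction with
  | base => simp
  | succ k hk ih =>
    rw [sum_stage_succ h₀ hkn (g (k + 1)) (hg (k + 1) (by omega) hkn),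
      Finset.prod_Icc_succ_top (by omega), mul_right_comm, ← ih (by omega), mul_comm,
      Finset.sum_mul]
    refine Finset.sum_congr rfl fun p hp => ?_
    rw [add_mul, Finset.mul_sum, Finset.mul_sum]
    congr 1 <;> refine Finset.sum_congr rfl fun σ hσ => ?_ <;>
      exact hF k hk hkn _ (by simpa using hp) σ (mem_stageFinset.mp hσ)

/-! ### Slots and their cyclic ranks. -/

theorem inv_natCast_mem_Icc {n : ℕ} {σ₀ : Perm ℤ} (h₀ : σ₀ ∈ typeB n)
    (hpos : ∀ k : ℕ, 1 ≤ k → k ≤ n → 0 < σ₀ (k : ℤ)) {k : ℕ} (hk : 1 ≤ k) (hkn : k ≤ n) :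
    1 ≤ σ₀⁻¹ (k : ℤ) ∧ σ₀⁻¹ (k : ℤ) ≤ n := by
  have h1 : |σ₀⁻¹ (k : ℤ)| ≤ n :=
    typeB_abs_le (typeB_inv h₀) (by rw [abs_of_nonneg] <;> omega)
  have h2 : σ₀⁻¹ (k : ℤ) ≠ 0 := typeB_ne_zero (typeB_inv h₀) (by omega)
  rw [abs_le] at h1
  refine ⟨?_, h1.2⟩
  by_contra hlt
  have h3 := hpos (-σ₀⁻¹ (k : ℤ)).toNat (by omega) (by omega)
  rw [Int.toNat_of_nonneg (by omega), h₀.1, apply_inv_self] at h3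
  omega

/-- Positivity makes `σ₀` permute `1, …, n`, so `k` positions carry a letter at most `k`. Since `σ₀
i ≤ r i`, all positions with `r i < k` are among these, and removing them leaves the rise height. In
particular the count does not depend on `σ₀`. -/
theorem card_slots {n : ℕ} {r : ℕ → ℕ} {σ₀ : Perm ℤ} (h₀ : σ₀ ∈ typeB n)
    (hpos : ∀ k : ℕ, 1 ≤ k → k ≤ n → 0 < σ₀ (k : ℤ))
    (hb : ∀ i : ℕ, i ∈ Finset.Icc 1 n → |σ₀ (i : ℤ)| ≤ (r i : ℤ)) {k : ℕ} (hkn : k ≤ n) :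
    (slots n r σ₀ k).card = riseHeight n r k := by
  have h1 : ((Finset.Icc 1 n).filter (fun i : ℕ => σ₀ (i : ℤ) ≤ k)).card = k := by
    refine Eq.trans ?_ ((Nat.card_Icc 1 k).trans (Nat.add_sub_cancel k 1))
    refine Finset.card_nbij' (fun i : ℕ => (σ₀ i).toNat) (fun j : ℕ => (σ₀⁻¹ j).toNat) ?_ ?_ ?_ ?_
    · intro i hi
      simp only [Finset.coe_filter, Finset.mem_Icc, Set.mem_ofPred_eq] at hi
      have := hpos i hi.1.1 hi.1.2
      simp only [Finset.coe_Icc, Set.mem_Icc]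
      omega
    · intro j hj
      simp only [Finset.coe_Icc, Set.mem_Icc] at hj
      have := inv_natCast_mem_Icc h₀ hpos hj.1 (hj.2.trans hkn)
      simp only [Finset.coe_filter, Finset.mem_Icc, Set.mem_ofPred_eq]
      rw [Int.toNat_of_nonneg (by omega), apply_inv_self]
      omega
    · intro i hi
      simp only [Finset.coe_filter, Finset.mem_Icc, Set.mem_ofPred_eq] at hi
      have := hpos i hi.1.1 hi.1.2
      simp only
      rw [Int.toNat_of_nonneg (by omega), inv_apply_self, Int.toNat_natCast]
    · intro j hj
      simp only [Finset.coe_Icc, Set.mem_Icc] at hj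
      have := inv_natCast_mem_Icc h₀ hpos hj.1 (hj.2.trans hkn)
      simp only
      rw [Int.toNat_of_nonneg (by omega), apply_inv_self, Int.toNat_natCast]
  have h2 : (Finset.Icc 1 n).filter (fun i => r i < k) =
      ((Finset.Icc 1 n).filter (fun i : ℕ => σ₀ (i : ℤ) ≤ k)).filter (fun i => ¬ k ≤ r i) := by
    ext i
    simp only [Finset.mem_filter, not_le]
    constructor
    · rintro ⟨hi, hlt⟩
      have := (le_abs_self _).trans (hb i hi)
      exact ⟨⟨hi, by omega⟩, hlt⟩
    · rintro ⟨⟨hi, -⟩, hlt⟩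
      exact ⟨hi, hlt⟩
  have h3 : slots n r σ₀ k =
      ((Finset.Icc 1 n).filter (fun i : ℕ => σ₀ (i : ℤ) ≤ k)).filter (fun i => k ≤ r i) := by
    ext i
    simp only [slots, Finset.mem_filter]
    tauto
  have h4 := Finset.card_filter_add_card_filter_not
    (s := (Finset.Icc 1 n).filter (fun i : ℕ => σ₀ (i : ℤ) ≤ k)) (fun i => k ≤ r i)
  rw [← h2, ← h3, h1] at h4
  unfold riseHeight
  omega

/-- The positions met when moving from `p` to `m` cyclically within `slots n r σ₀ k`, without
`m` itself. -/
def cyclicBetween (n : ℕ) (r : ℕ → ℕ) (σ₀ : Perm ℤ) (k : ℕ) (m : ℤ) (p : ℕ) : Finset ℕ :=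
  if (p : ℤ) ≤ m then
    (Finset.Icc 1 n).filter (fun i : ℕ => (p : ℤ) ≤ (i : ℤ) ∧ (i : ℤ) ≤ m ∧ σ₀ (i : ℤ) < (k : ℤ))
  else
    (Finset.Icc 1 n).filter (fun i : ℕ =>
      k ≤ r i ∧ ¬(m < (i : ℤ) ∧ (i : ℤ) < p) ∧ σ₀ (i : ℤ) < (k : ℤ))

/-- The rank of a slot in the cyclic order that ends at the place of `k` in `σ₀`. -/
def slotRank (n : ℕ) (r : ℕ → ℕ) (σ₀ : Perm ℤ) (k p : ℕ) : ℕ :=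
  (cyclicBetween n r σ₀ k (σ₀⁻¹ (k : ℤ)) p).card

theorem relSorTerm_eq (n : ℕ) (r : ℕ → ℕ) (σ₀ : Perm ℤ) (k : ℕ) (σ : Perm ℤ) :
    relSorTerm n r σ₀ k σ = if 0 < σ⁻¹ (k : ℤ) then slotRank n r σ₀ k (σ⁻¹ (k : ℤ)).natAbs
      else 2 * k - 2 - slotRank n r σ₀ k (σ⁻¹ (k : ℤ)).natAbs := by
  unfold relSorTerm slotRank cyclicBetween
  simp only [Int.natCast_natAbs, apply_ite Finset.card]

theorem mem_slots_self {n : ℕ} {r : ℕ → ℕ} {σ₀ : Perm ℤ} (h₀ : σ₀ ∈ typeB n)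
    (hpos : ∀ k : ℕ, 1 ≤ k → k ≤ n → 0 < σ₀ (k : ℤ))
    (hb : ∀ i : ℕ, i ∈ Finset.Icc 1 n → |σ₀ (i : ℤ)| ≤ (r i : ℤ)) {k : ℕ} (hk : 1 ≤ k)
    (hkn : k ≤ n) : (σ₀⁻¹ (k : ℤ)).natAbs ∈ slots n r σ₀ k := by
  have hm := inv_natCast_mem_Icc h₀ hpos hk hkn
  have hc : ((σ₀⁻¹ (k : ℤ)).natAbs : ℤ) = σ₀⁻¹ (k : ℤ) := by omega
  have h1 := hb (σ₀⁻¹ (k : ℤ)).natAbs (Finset.mem_Icc.mpr (by omega))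
  rw [hc, apply_inv_self, abs_of_nonneg (by omega)] at h1
  rw [mem_slots, hc, apply_inv_self]
  omega

theorem cyclicBetween_subset {n : ℕ} {r : ℕ → ℕ} {σ₀ : Perm ℤ} {k m p : ℕ}
    (hmono : ∀ i j : ℕ, 1 ≤ i → i ≤ j → j ≤ n → r i ≤ r j) (hp : p ∈ slots n r σ₀ k)
    (hm : σ₀ (m : ℤ) = k) :
    cyclicBetween n r σ₀ k m p ⊆ (slots n r σ₀ k).erase m := by
  have hp' := mem_slots.mp hp
  intro i hi
  rw [Finset.mem_erase, mem_slots]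
  unfold cyclicBetween at hi
  split_ifs at hi with h
  · simp only [Finset.mem_filter, Finset.mem_Icc] at hi
    -- The first branch of the definition does not ask for `k ≤ r i`. Here it follows from `p ≤ i`
    -- and monotonicity.
    have := hmono p i hp'.1.1 (by omega) hi.1.2
    refine ⟨?_, hi.1, by omega, by omega⟩
    rintro rfl
    omega
  · simp only [Finset.mem_filter, Finset.mem_Icc] at hi
    refine ⟨?_, hi.1, by omega, by omega⟩
    rintro rfl
    omega

/-- For two slots the sets are strictly nested: the slot met earlier on the cyclic way to `m` has
the larger set, which contains that slot itself while the other set does not. The cases are `p < p'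
≤ m`, `p ≤ m < p'` and `m < p < p'`. -/
theorem card_cyclicBetween_ne {n : ℕ} {r : ℕ → ℕ} {σ₀ : Perm ℤ} {k m p p' : ℕ}
    (hmono : ∀ i j : ℕ, 1 ≤ i → i ≤ j → j ≤ n → r i ≤ r j) (hp : p ∈ slots n r σ₀ k)
    (hp' : p' ∈ slots n r σ₀ k) (hm : σ₀ (m : ℤ) = k) (hlt : p < p') :
    (cyclicBetween n r σ₀ k m p).card ≠ (cyclicBetween n r σ₀ k m p').card := by
  have key : ∀ x, x ∈ slots n r σ₀ k → x ≠ m → σ₀ (x : ℤ) < k := by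
    intro x hx hxm
    refine lt_of_le_of_ne (mem_slots.mp hx).2.2 fun h => hxm ?_
    exact_mod_cast σ₀.injective (h.trans hm.symm)
  have h1 := mem_slots.mp hp
  have h2 := mem_slots.mp hp'
  unfold cyclicBetween
  by_cases hc : p' ≤ m
  · have := key p hp (by omega)
    rw [if_pos (by omega), if_pos (by omega)]
    refine (Finset.card_lt_card ((Finset.ssubset_iff_of_subset ?_).mpr ⟨p, ?_, ?_⟩)).ne'
    · intro i hi
      simp only [Finset.mem_filter, Finset.mem_Icc] at hi ⊢
      omega
    · simp only [Finset.mem_filter, Finset.mem_Icc]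
      omega
    · simp only [Finset.mem_filter, Finset.mem_Icc]
      omega
  have := key p' hp' (by omega)
  by_cases hc' : p ≤ m
  · rw [if_pos (by omega), if_neg (by omega)]
    refine (Finset.card_lt_card ((Finset.ssubset_iff_of_subset ?_).mpr ⟨p', ?_, ?_⟩)).ne
    · intro i hi
      simp only [Finset.mem_filter, Finset.mem_Icc] at hi ⊢
      have := hmono p i (by omega) (by omega) (by omega)
      omega
    · simp only [Finset.mem_filter, Finset.mem_Icc]
      omega
    · simp only [Finset.mem_filter, Finset.mem_Icc]
      omega
  · have := key p hp (by omega)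
    rw [if_neg (by omega), if_neg (by omega)]
    refine (Finset.card_lt_card ((Finset.ssubset_iff_of_subset ?_).mpr ⟨p, ?_, ?_⟩)).ne'
    · intro i hi
      simp only [Finset.mem_filter, Finset.mem_Icc] at hi ⊢
      omega
    · simp only [Finset.mem_filter, Finset.mem_Icc]
      omega
    · simp only [Finset.mem_filter, Finset.mem_Icc]
      omega

theorem cyclicBetween_self {n : ℕ} {r : ℕ → ℕ} {σ₀ : Perm ℤ} {k m : ℕ} (hm : σ₀ (m : ℤ) = k) :
    cyclicBetween n r σ₀ k m m = ∅ := by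
  unfold cyclicBetween
  rw [if_pos le_rfl, Finset.filter_eq_empty_iff]
  rintro i - ⟨h1, h2, h3⟩
  have : i = m := by omega
  rw [this] at h3
  omega

section

variable {n : ℕ} {r : ℕ → ℕ} {σ₀ : Perm ℤ} {k : ℕ}

/-- The hypotheses on a bound `r` and a positive word `σ₀`. -/
structure Admissible (n : ℕ) (r : ℕ → ℕ) (σ₀ : Perm ℤ) : Prop where
  mono : ∀ i j : ℕ, 1 ≤ i → i ≤ j → j ≤ n → r i ≤ r j
  mem : σ₀ ∈ typeB n
  pos : ∀ k : ℕ, 1 ≤ k → k ≤ n → 0 < σ₀ (k : ℤ)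
  bound : ∀ i : ℕ, i ∈ Finset.Icc 1 n → |σ₀ (i : ℤ)| ≤ (r i : ℤ)

theorem Admissible.exists_place (H : Admissible n r σ₀) (hk : 1 ≤ k) (hkn : k ≤ n) :
    ∃ m : ℕ, m ∈ slots n r σ₀ k ∧ σ₀⁻¹ (k : ℤ) = m ∧ σ₀ (m : ℤ) = k := by
  have h1 := inv_natCast_mem_Icc H.mem H.pos hk hkn
  have h2 : σ₀⁻¹ (k : ℤ) = ((σ₀⁻¹ (k : ℤ)).natAbs : ℤ) := by omega
  exact ⟨_, mem_slots_self H.mem H.pos H.bound hk hkn, h2, by rw [← h2, apply_inv_self]⟩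

theorem Admissible.card_slots (H : Admissible n r σ₀) (hkn : k ≤ n) :
    (slots n r σ₀ k).card = riseHeight n r k :=
  RestrictedD.card_slots H.mem H.pos H.bound hkn

theorem Admissible.riseHeight_pos (H : Admissible n r σ₀) (hk : 1 ≤ k) (hkn : k ≤ n) :
    1 ≤ riseHeight n r k := by
  obtain ⟨m, hm, -⟩ := H.exists_place hk hkn
  rw [← H.card_slots hkn]
  exact Finset.card_pos.mpr ⟨m, hm⟩

theorem riseHeight_le (n : ℕ) (r : ℕ → ℕ) (k : ℕ) : riseHeight n r k ≤ k := Nat.sub_le _ _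

theorem Admissible.slotRank_lt (H : Admissible n r σ₀) (hk : 1 ≤ k) (hkn : k ≤ n) {p : ℕ}
    (hp : p ∈ slots n r σ₀ k) : slotRank n r σ₀ k p < riseHeight n r k := by
  obtain ⟨m, hm, h1, h2⟩ := H.exists_place hk hkn
  have h3 := Finset.card_le_card (cyclicBetween_subset H.mono hp h2)
  rw [Finset.card_erase_of_mem hm, H.card_slots hkn] at h3
  have := H.riseHeight_pos hk hkn
  unfold slotRank
  rw [h1]
  omega

theorem Admissible.slotRank_injOn (H : Admissible n r σ₀) (hk : 1 ≤ k) (hkn : k ≤ n) :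
    Set.InjOn (slotRank n r σ₀ k) (slots n r σ₀ k : Set ℕ) := by
  obtain ⟨m, -, h1, h2⟩ := H.exists_place hk hkn
  intro p hp p' hp' h
  unfold slotRank at h
  rw [h1] at h
  rcases lt_trichotomy p p' with h3 | h3 | h3
  · exact absurd h (card_cyclicBetween_ne H.mono hp hp' h2 h3)
  · exact h3
  · exact absurd h.symm (card_cyclicBetween_ne H.mono hp' hp h2 h3)

theorem Admissible.slotRank_eq_zero_iff (H : Admissible n r σ₀) (hk : 1 ≤ k) (hkn : k ≤ n) {p : ℕ}
    (hp : p ∈ slots n r σ₀ k) : slotRank n r σ₀ k p = 0 ↔ σ₀⁻¹ (k : ℤ) = p := by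
  obtain ⟨m, hm, h1, h2⟩ := H.exists_place hk hkn
  have h0 : slotRank n r σ₀ k m = 0 := by
    unfold slotRank
    rw [h1, cyclicBetween_self h2, Finset.card_empty]
  rw [h1, Nat.cast_inj]
  constructor
  · intro h
    exact (H.slotRank_injOn hk hkn hm hp (h0.trans h.symm))
  · rintro rfl
    exact h0

/-- Pigeonhole: the `h` slots have distinct ranks below `h`, so the ranks are exactly `0, …, h - 1`.
-/
theorem Admissible.sum_slots {M : Type*} [AddCommMonoid M] (H : Admissible n r σ₀) (hk : 1 ≤ k)
    (hkn : k ≤ n) (f : ℕ → M) :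
    ∑ p ∈ slots n r σ₀ k, f (slotRank n r σ₀ k p) =
      ∑ j ∈ Finset.range (riseHeight n r k), f j := by
  rw [← Finset.sum_image (H.slotRank_injOn hk hkn)]
  congr 1
  refine Finset.eq_of_subset_of_card_le ?_ ?_
  · intro j hj
    obtain ⟨p, hp, rfl⟩ := Finset.mem_image.mp hj
    exact Finset.mem_range.mpr (H.slotRank_lt hk hkn hp)
  · rw [Finset.card_range, Finset.card_image_of_injOn (H.slotRank_injOn hk hkn),
      H.card_slots hkn]

end

/-! ### Sums of powers of `q` over the ranks. -/

theorem sum_pow_sub {R : Type*} [CommSemiring R] (q : R) {c h : ℕ} (hc : h ≤ c + 1) :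
    ∑ j ∈ Finset.range h, q ^ (c - j) = q ^ (c + 1 - h) * qInt q h := by
  unfold qInt
  rw [← Finset.sum_range_reflect, Finset.mul_sum]
  refine Finset.sum_congr rfl fun j hj => ?_
  rw [Finset.mem_range] at hj
  rw [← pow_add]
  congr 1
  omega

theorem sum_pow_succ {R : Type*} [CommSemiring R] (q : R) (h : ℕ) :
    ∑ j ∈ Finset.range h, q ^ (j + 1) = q * qInt q h := by
  unfold qInt
  rw [Finset.mul_sum]
  exact Finset.sum_congr rfl fun j _ => pow_succ' q j

theorem sum_inv_weight {R : Type*} [CommSemiring R] (q t : R) {k h : ℕ} (hh : 1 ≤ h)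
    (hk : h ≤ k) :
    ∑ j ∈ Finset.range h, ((if j = 0 then t else q ^ j) + q ^ (2 * k - 2 - j)) =
      t + q * qInt q (h - 1) + q ^ (2 * k - h - 1) * qInt q h := by
  obtain ⟨h, rfl⟩ := Nat.exists_eq_add_of_le' hh
  rw [Finset.sum_add_distrib, sum_pow_sub q (by omega), Finset.sum_range_succ']
  simp only [Nat.add_eq_zero_iff, one_ne_zero, and_false, if_false, if_true, sum_pow_succ,
    Nat.add_sub_cancel]
  rw [add_comm t, show 2 * k - 2 + 1 - (h + 1) = 2 * k - (h + 1) - 1 by omega]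

theorem sum_sor_weight {R : Type*} [CommSemiring R] (q t s : R) {k h : ℕ} (hh : 1 ≤ h)
    (hk : h ≤ k) :
    ∑ j ∈ Finset.range h, ((if j = 0 then t else q ^ j) +
        (if j = 0 then q ^ (2 * k - 2) * s else q ^ (2 * k - 2 - j))) =
      t + (q + q ^ (2 * k - h - 1)) * qInt q (h - 1) + q ^ (2 * k - 2) * s := by
  obtain ⟨h, rfl⟩ := Nat.exists_eq_add_of_le' hh
  have h1 : ∑ j ∈ Finset.range h, q ^ (2 * k - 2 - (j + 1)) =
      q ^ (2 * k - (h + 1) - 1) * qInt q h := by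
    -- The rewriting below fails for `h = 0`, `k = 1`, where `2 * k - 3` is truncated.
    rcases Nat.eq_zero_or_pos h with rfl | h0
    · simp [qInt]
    rw [show 2 * k - (h + 1) - 1 = 2 * k - 3 + 1 - h by omega, ← sum_pow_sub q (by omega)]
    refine Finset.sum_congr rfl fun j _ => ?_
    congr 1
    omega
  rw [Finset.sum_add_distrib, Finset.sum_range_succ', Finset.sum_range_succ']
  simp only [Nat.add_eq_zero_iff, one_ne_zero, and_false, if_false, if_true, sum_pow_succ,
    Nat.add_sub_cancel, h1]
  ring

/-! ### Signed transpositions as moves. -/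

theorem signedSwap_apply {i j : ℤ} (hj : 0 < j) (hi : i ≠ 0) (x : ℤ) :
    signedSwap i j x =
      if x = j then i else if x = i then j else if x = -j then -i else if x = -i then -j else x := by
  unfold signedSwap
  split_ifs <;> simp only [Perm.mul_apply, Equiv.swap_apply_def] <;> grind

theorem signedSwap_mul_self {i j : ℤ} (hj : 0 < j) (hi : i ≠ 0) :
    signedSwap i j * signedSwap i j = 1 := by
  ext x
  rw [Perm.mul_apply, Perm.one_apply, signedSwap_apply hj hi x]
  split_ifs <;> rw [signedSwap_apply hj hi] <;> grind

theorem signedSwap_inv {i j : ℤ} (hj : 0 < j) (hi : i ≠ 0) :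
    (signedSwap i j)⁻¹ = signedSwap i j :=
  inv_eq_of_mul_eq_one_left (signedSwap_mul_self hj hi)

theorem signedSwap_mem_typeB {n : ℕ} {i j : ℤ} (hj : 0 < j) (hjn : j ≤ n) (hi : i ≠ 0)
    (hin : |i| ≤ n) : signedSwap i j ∈ typeB n := by
  rw [abs_le] at hin
  refine ⟨fun x => ?_, fun x hx => ?_⟩
  · rw [signedSwap_apply hj hi, signedSwap_apply hj hi]
    grind
  · rw [signedSwap_apply hj hi]
    rw [lt_abs] at hx
    grind

theorem Admissible.isMove_signedSwap {n : ℕ} {r : ℕ → ℕ} {σ₀ : Perm ℤ} {k : ℕ}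
    (H : Admissible n r σ₀) (hk : 1 ≤ k) (hkn : k ≤ n) {l : ℤ}
    (hl : l.natAbs ∈ slots n r σ₀ k) :
    IsMove n r σ₀ k l (signedSwap l (σ₀⁻¹ (k : ℤ))) := by
  obtain ⟨m, hm, h1, h2⟩ := H.exists_place hk hkn
  have hl' := mem_slots.mp hl
  have hm' := mem_slots.mp hm
  have hl0 : l ≠ 0 := by omega
  have hm0 : (0 : ℤ) < m := by omega
  -- The slot condition on `|l|`: positions `±l` carry letters of `σ₀` of absolute value at most
  -- `k`, so the swap leaves the places of larger letters alone.
  have hval : ∀ x : ℤ, x = l ∨ x = -l → |σ₀ x| ≤ k := by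
    intro x hx
    have h3 : |σ₀ x| = |σ₀ (l.natAbs : ℤ)| := by
      rw [Int.natCast_natAbs, typeB_apply_abs H.mem]
      rcases hx with rfl | rfl
      · rfl
      · rw [H.mem.1, abs_neg]
    rw [h3, abs_of_pos (H.pos _ hl'.1.1 hl'.1.2)]
    exact hl'.2.2
  rw [h1]
  refine ⟨signedSwap_mem_typeB hm0 (by omega) hl0 (by rw [abs_le]; omega), ?_, ?_, ?_⟩
  · rw [signedSwap_apply hm0 hl0, h1, if_pos rfl]
  · intro j hj
    rw [signedSwap_apply hm0 hl0]
    have e1 : σ₀⁻¹ j ≠ m := by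
      intro h
      rw [Perm.inv_eq_iff_eq, h2] at h
      subst h
      simp at hj
    have e2 : σ₀⁻¹ j ≠ -m := by
      intro h
      rw [Perm.inv_eq_iff_eq, H.mem.1, h2] at h
      subst h
      simp at hj
    have e3 : σ₀⁻¹ j ≠ l := by
      intro h
      have := hval (σ₀⁻¹ j) (Or.inl h)
      rw [apply_inv_self] at this
      omega
    have e4 : σ₀⁻¹ j ≠ -l := by
      intro h
      have := hval (σ₀⁻¹ j) (Or.inr h)
      rw [apply_inv_self] at this
      omega
    rw [if_neg e1, if_neg e3, if_neg e2, if_neg e4]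
  · intro i hi hne
    rw [signedSwap_apply hm0 hl0] at hne
    have : i = m ∨ i = l.natAbs := by grind
    rcases this with rfl | rfl
    · exact hm'.2.1
    · exact hl'.2.1

/-! ### Cycles under insertion of a largest letter. -/

/-- Two permutations have the same cycle relation along `f` if `f` respects single steps. -/
theorem sameCycle_of_step {p π : Perm ℤ} {f : ℤ → ℤ}
    (h : ∀ z, p.SameCycle (f z) (f (π z))) {x y : ℤ} (hxy : π.SameCycle x y) :
    p.SameCycle (f x) (f y) := by
  obtain ⟨i, rfl⟩ := hxy
  induction i with
  | zero => exact Perm.SameCycle.refl _ _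
  | succ i ih =>
    rw [add_comm, zpow_add, Perm.mul_apply, zpow_one]
    exact ih.trans (h _)
  | pred i ih =>
    refine ih.trans (Perm.SameCycle.symm ?_)
    have := h ((π ^ (-(i : ℤ) - 1)) x)
    rwa [← Perm.mul_apply, ← zpow_one_add, add_sub_cancel] at this

/-- Since `p` fixes `c`, the product sends `a` to `c` and `c` to `p a`: it inserts `c` into the
cycle of `a` just after `a`, and the other points stay related as before. -/
theorem sameCycle_mul_swap {p : Perm ℤ} {a c x y : ℤ} (hc : p c = c) (hx : x ≠ c) (hy : y ≠ c) :
    (p * Equiv.swap a c).SameCycle x y ↔ p.SameCycle x y := by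
  by_cases hac : a = c
  · subst hac
    rw [Equiv.swap_self, ← Perm.one_def, mul_one]
  have hne : ∀ z, z ≠ c → p z ≠ c := fun z hz h => hz (p.injective (h.trans hc.symm))
  constructor
  · intro h
    -- Contracting `c` onto `a` turns steps of the product into steps of `p` or no step.
    have := sameCycle_of_step (p := p) (f := fun z => if z = c then a else z) ?_ h
    · simpa [hx, hy] using this
    · intro z
      rw [Perm.mul_apply]
      by_cases h1 : z = c
      · subst h1
        rw [if_pos rfl, Equiv.swap_apply_right, if_neg (hne a hac)]
        exact ⟨1, by simp⟩
      by_cases h2 : z = a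
      · subst h2
        rw [if_neg hac, Equiv.swap_apply_left, hc, if_pos rfl]
      · rw [Equiv.swap_apply_of_ne_of_ne h2 h1, if_neg h1, if_neg (hne z h1)]
        exact ⟨1, by simp⟩
  · intro h
    refine sameCycle_of_step (f := id) ?_ h
    intro z
    simp only [id]
    by_cases h1 : z = c
    · rw [h1, hc]
    by_cases h2 : z = a
    · refine ⟨2, ?_⟩
      rw [zpow_two, h2, Perm.mul_apply, Perm.mul_apply p _ a, Equiv.swap_apply_left, hc,
        Perm.mul_apply, Equiv.swap_apply_right]
    · refine ⟨1, ?_⟩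
      rw [zpow_one, Perm.mul_apply, Equiv.swap_apply_of_ne_of_ne h2 h1]

theorem sameCycle_mul_signedSwap {p : Perm ℤ} {j k x y : ℤ} (hk : 0 < k) (hp : p k = k)
    (hp' : p (-k) = -k) (hx : x ≠ k) (hx' : x ≠ -k) (hy : y ≠ k) (hy' : y ≠ -k) :
    (p * signedSwap j k).SameCycle x y ↔ p.SameCycle x y := by
  unfold signedSwap
  split_ifs with h
  · exact sameCycle_mul_swap hp hx hy
  · by_cases hjk : j = k
    · subst hjk
      rw [Equiv.swap_self, Equiv.swap_self, ← Perm.one_def, mul_one, mul_one]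
    rw [← mul_assoc, sameCycle_mul_swap ?_ hx' hy', sameCycle_mul_swap hp hx hy]
    rw [Perm.mul_apply, Equiv.swap_apply_of_ne_of_ne (by omega) (by omega), hp']

/-- Converts an exchange of positions into an exchange of letters. -/
theorem conj_signedSwap {n : ℕ} {σ : Perm ℤ} (hσ : σ ∈ typeB n) (i j : ℤ) :
    σ * signedSwap i j = signedSwap (σ i) (σ j) * σ := by
  unfold signedSwap
  have h : σ i = -σ j ↔ i = -j := by rw [← hσ.1, σ.injective.eq_iff]
  simp only [h]
  split_ifs
  · rw [Equiv.swap_apply_apply, inv_mul_cancel_right]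
  · rw [← hσ.1, ← hσ.1, Equiv.swap_apply_apply, Equiv.swap_apply_apply]
    group

section

variable {p : Perm ℤ} {k : ℕ} {j : ℤ}

theorem minimal_mul_signedSwap_iff (hp : p ((k + 1 : ℕ) : ℤ) = (k + 1 : ℕ))
    (hp' : p (-((k + 1 : ℕ) : ℤ)) = -((k + 1 : ℕ) : ℤ)) {i : ℕ} (hi : 1 ≤ i) (hik : i ≤ k) :
    (∀ m : ℤ, (p * signedSwap j ((k + 1 : ℕ) : ℤ)).SameCycle (i : ℤ) m → (i : ℤ) ≤ |m|) ↔
      ∀ m : ℤ, p.SameCycle (i : ℤ) m → (i : ℤ) ≤ |m| := by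
  refine forall_congr' fun m => ?_
  by_cases h1 : m = ((k + 1 : ℕ) : ℤ)
  · have : (i : ℤ) ≤ |m| := by rw [h1, abs_of_nonneg] <;> omega
    simp [this]
  by_cases h2 : m = -((k + 1 : ℕ) : ℤ)
  · have : (i : ℤ) ≤ |m| := by rw [h2, abs_neg, abs_of_nonneg] <;> omega
    simp [this]
  rw [sameCycle_mul_signedSwap (by omega) hp hp' (by omega) (by omega) h1 h2]

theorem balanced_mul_signedSwap_iff (hp : p ((k + 1 : ℕ) : ℤ) = (k + 1 : ℕ))
    (hp' : p (-((k + 1 : ℕ) : ℤ)) = -((k + 1 : ℕ) : ℤ)) {i : ℕ} (hi : 1 ≤ i) (hik : i ≤ k) :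
    (p * signedSwap j ((k + 1 : ℕ) : ℤ)).SameCycle (i : ℤ) (-i) ↔ p.SameCycle (i : ℤ) (-i) :=
  sameCycle_mul_signedSwap (by omega) hp hp' (by omega) (by omega) (by omega) (by omega)

theorem eq_of_sameCycle_fixed {x m : ℤ} (hp : p x = x) (h : p.SameCycle x m) : m = x := by
  obtain ⟨i, rfl⟩ := h
  exact Perm.zpow_apply_eq_self_of_apply_eq_self hp i

/-- The product maps `j` to `k + 1`, so `j` lies in that cycle and must not be smaller in absolute
value. Conversely, if `|j| = k + 1`, the pair `±(k + 1)` is invariant. -/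
theorem minimal_top_iff (hp : p ((k + 1 : ℕ) : ℤ) = (k + 1 : ℕ))
    (hp' : p (-((k + 1 : ℕ) : ℤ)) = -((k + 1 : ℕ) : ℤ)) (hj : j ≠ 0) (hjk : |j| ≤ (k + 1 : ℕ)) :
    (∀ m : ℤ, (p * signedSwap j ((k + 1 : ℕ) : ℤ)).SameCycle ((k + 1 : ℕ) : ℤ) m →
      ((k + 1 : ℕ) : ℤ) ≤ |m|) ↔ |j| = (k + 1 : ℕ) := by
  have hk : (0 : ℤ) < (k + 1 : ℕ) := by omega
  set K : ℤ := ((k + 1 : ℕ) : ℤ)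
  constructor
  · intro h
    refine le_antisymm hjk (h j (Perm.SameCycle.symm ⟨1, ?_⟩))
    rw [zpow_one, Perm.mul_apply, signedSwap_apply hk hj]
    by_cases h1 : j = K
    · rw [if_pos h1, h1, hp]
    · rw [if_neg h1, if_pos rfl, hp]
  · intro h m hm
    -- The cycles of the identity are points, so this says that the indicator of `±(k + 1)` is
    -- constant along cycles.
    have key := sameCycle_of_step (p := 1) (f := fun z => if |z| = K then 1 else 0) ?_ hm
    · rw [Perm.sameCycle_one, if_pos (abs_of_pos hk)] at key
      by_contra hlt
      rw [if_neg (by omega)] at key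
      exact one_ne_zero key
    · intro z
      rw [Perm.sameCycle_one]
      have hf : ∀ y, |p y| = K ↔ |y| = K := by
        intro y
        have h1 : p y = K ↔ y = K := ⟨fun h => p.injective (h.trans hp.symm), fun h => h ▸ hp⟩
        have h2 : p y = -K ↔ y = -K := ⟨fun h => p.injective (h.trans hp'.symm), fun h => h ▸ hp'⟩
        rw [abs_eq hk.le, abs_eq hk.le, h1, h2]
      rw [Perm.mul_apply]
      simp only [hf]
      congr 1
      rw [signedSwap_apply hk hj]
      rw [abs_eq hk.le] at h
      simp only [abs_eq hk.le, eq_iff_iff]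
      grind

theorem balanced_top_iff (hp : p ((k + 1 : ℕ) : ℤ) = (k + 1 : ℕ))
    (hp' : p (-((k + 1 : ℕ) : ℤ)) = -((k + 1 : ℕ) : ℤ)) (hjk : |j| = (k + 1 : ℕ)) :
    (p * signedSwap j ((k + 1 : ℕ) : ℤ)).SameCycle ((k + 1 : ℕ) : ℤ) (-((k + 1 : ℕ) : ℤ)) ↔
      j = -((k + 1 : ℕ) : ℤ) := by
  have hk : (0 : ℤ) < (k + 1 : ℕ) := by omega
  set K : ℤ := ((k + 1 : ℕ) : ℤ)
  constructor
  · intro h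
    rcases (abs_eq hk.le).mp hjk with h1 | h1
    · have := eq_of_sameCycle_fixed (x := K) ?_ h
      · omega
      · rw [Perm.mul_apply, signedSwap_apply hk (by omega), if_pos rfl, h1, hp]
    · exact h1
  · intro h
    refine ⟨1, ?_⟩
    rw [zpow_one, Perm.mul_apply, signedSwap_apply hk (by omega), if_pos rfl, h, hp']

theorem cyc0_mul_signedSwap (hp : p ((k + 1 : ℕ) : ℤ) = (k + 1 : ℕ))
    (hp' : p (-((k + 1 : ℕ) : ℤ)) = -((k + 1 : ℕ) : ℤ)) (hj : j ≠ 0) (hjk : |j| ≤ (k + 1 : ℕ)) :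
    cyc0 (k + 1) (p * signedSwap j ((k + 1 : ℕ) : ℤ)) =
      if j = (k + 1 : ℕ) then insert (k + 1) (cyc0 k p) else cyc0 k p := by
  classical
  ext i
  have hL : i ∈ (if j = (k + 1 : ℕ) then insert (k + 1) (cyc0 k p) else cyc0 k p) ↔
      (i = k + 1 ∧ j = (k + 1 : ℕ)) ∨ i ∈ cyc0 k p := by
    split_ifs with h <;> simp only [h, Finset.mem_insert, and_true, and_false, false_or]
  rw [hL]
  unfold cyc0
  simp only [Finset.mem_filter, Finset.mem_Icc]
  rcases Nat.lt_or_ge k i with hki | hki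
  · by_cases hi : i = k + 1
    · subst hi
      rw [minimal_top_iff hp hp' hj hjk]
      have h2 := balanced_top_iff (j := j) hp hp'
      constructor
      · rintro ⟨-, h3, h4⟩
        rw [h2 h3] at h4
        rcases (abs_eq (by omega)).mp h3 with h5 | h5
        · exact Or.inl ⟨rfl, h5⟩
        · exact absurd h5 h4
      · rintro (⟨-, h3⟩ | h3)
        · have h4 : |j| = ((k + 1 : ℕ) : ℤ) := by rw [h3, abs_of_nonneg]; omega
          refine ⟨by omega, h4, ?_⟩
          rw [h2 h4]
          omega
        · omega
    · omega
  · by_cases hi : 1 ≤ i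
    · rw [minimal_mul_signedSwap_iff hp hp' hi hki, balanced_mul_signedSwap_iff hp hp' hi hki]
      have : i ≠ k + 1 := by omega
      have : i ≤ k + 1 := by omega
      tauto
    · omega

theorem cyc1_mul_signedSwap (hp : p ((k + 1 : ℕ) : ℤ) = (k + 1 : ℕ))
    (hp' : p (-((k + 1 : ℕ) : ℤ)) = -((k + 1 : ℕ) : ℤ)) (hj : j ≠ 0) (hjk : |j| ≤ (k + 1 : ℕ)) :
    cyc1 (k + 1) (p * signedSwap j ((k + 1 : ℕ) : ℤ)) =
      if j = -((k + 1 : ℕ) : ℤ) then insert (k + 1) (cyc1 k p) else cyc1 k p := by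
  classical
  ext i
  have hL : i ∈ (if j = -((k + 1 : ℕ) : ℤ) then insert (k + 1) (cyc1 k p) else cyc1 k p) ↔
      (i = k + 1 ∧ j = -((k + 1 : ℕ) : ℤ)) ∨ i ∈ cyc1 k p := by
    split_ifs with h <;> simp only [h, Finset.mem_insert, and_true, and_false, false_or]
  rw [hL]
  unfold cyc1
  simp only [Finset.mem_filter, Finset.mem_Icc]
  rcases Nat.lt_or_ge k i with hki | hki
  · by_cases hi : i = k + 1
    · subst hi
      rw [minimal_top_iff hp hp' hj hjk]
      have h2 := balanced_top_iff (j := j) hp hp'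
      constructor
      · rintro ⟨-, h3, h4⟩
        exact Or.inl ⟨rfl, (h2 h3).mp h4⟩
      · rintro (⟨-, h3⟩ | h3)
        · have h4 : |j| = ((k + 1 : ℕ) : ℤ) := by rw [h3, abs_neg, abs_of_nonneg]; omega
          exact ⟨by omega, h4, (h2 h4).mpr h3⟩
        · omega
    · omega
  · by_cases hi : 1 ≤ i
    · rw [minimal_mul_signedSwap_iff hp hp' hi hki, balanced_mul_signedSwap_iff hp hp' hi hki]
      have : i ≠ k + 1 := by omega
      have : i ≤ k + 1 := by omega
      tauto
    · omega

end

theorem succ_notMem_cyc0' (k : ℕ) (p : Perm ℤ) : k + 1 ∉ cyc0' k p := by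
  simp [cyc0', cyc0]

theorem succ_notMem_cyc1' (k : ℕ) (p : Perm ℤ) : k + 1 ∉ cyc1' k p := by
  simp [cyc1', cyc1]

theorem cyc0'_one (p : Perm ℤ) : cyc0' 1 p = ∅ := by
  ext i
  simp only [cyc0', cyc0, Finset.mem_erase, Finset.mem_filter, Finset.mem_Icc, Finset.notMem_empty,
    iff_false]
  rintro ⟨h1, h2, -⟩
  omega

theorem cyc1'_one (p : Perm ℤ) : cyc1' 1 p = ∅ := by
  ext i
  simp only [cyc1', cyc1, Finset.mem_erase, Finset.mem_filter, Finset.mem_Icc, Finset.notMem_empty,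
    iff_false]
  rintro ⟨h1, h2, -⟩
  omega

theorem relSorAux_succ (n : ℕ) (r : ℕ → ℕ) (σ₀ σ : Perm ℤ) {k : ℕ} (hk : 1 ≤ k) :
    relSorAux n r σ₀ (k + 1) σ = relSorTerm n r σ₀ (k + 1) σ + relSorAux n r σ₀ k
      (σ * signedSwap (σ⁻¹ ((k + 1 : ℕ) : ℤ)) (σ₀⁻¹ ((k + 1 : ℕ) : ℤ))) := by
  obtain ⟨k, rfl⟩ := Nat.exists_eq_add_of_le' hk
  rfl

/-! ### The last stage and the sorting generating function. -/

/-- The sign change of the letter `1`. -/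
def flipOne : Perm ℤ := Equiv.swap (-1) 1

theorem flipOne_apply (x : ℤ) : flipOne x = if x = -1 then 1 else if x = 1 then -1 else x :=
  Equiv.swap_apply_def _ _ _

theorem flipOne_mul_self : flipOne * flipOne = 1 := Equiv.swap_mul_self _ _

theorem flipOne_inv : flipOne⁻¹ = flipOne := Equiv.swap_inv _ _

theorem abs_flipOne (x : ℤ) : |flipOne x| = |x| := by
  rw [flipOne_apply]
  split_ifs with h1 h2 <;> simp [*]

theorem flipOne_of_one_lt {x : ℤ} (hx : 1 < |x|) : flipOne x = x := by
  rw [flipOne_apply, if_neg, if_neg] <;> rintro rfl <;> simp at hx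

theorem flipOne_mem_typeB {n : ℕ} (hn : 1 ≤ n) : flipOne ∈ typeB n := by
  refine ⟨fun x => ?_, fun x hx => flipOne_of_one_lt (by omega)⟩
  rw [flipOne_apply, flipOne_apply]
  grind

/-- Only the sign of the letter `1` is still free. -/
theorem stageFinset_one {n : ℕ} {r : ℕ → ℕ} {σ₀ : Perm ℤ} (hn : 1 ≤ n)
    (h₀ : σ₀ ∈ typeB n) (hb : ∀ i : ℕ, i ∈ Finset.Icc 1 n → |σ₀ (i : ℤ)| ≤ (r i : ℤ)) :
    (stageFinset n r σ₀ 1).card = 2 := by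
  classical
  have h : stageFinset n r σ₀ 1 = {σ₀, flipOne * σ₀} := by
    ext σ
    rw [mem_stageFinset, Finset.mem_insert, Finset.mem_singleton]
    constructor
    · rintro ⟨hB, -, hf⟩
      have hBm := typeB_mul hB (typeB_inv h₀)
      have h1 : ∀ z : ℤ, 1 < |z| → (σ * σ₀⁻¹) z = z := by
        intro z hz
        rw [Perm.mul_apply, ← hf z (by exact_mod_cast hz), apply_inv_self]
      have h2 : (σ * σ₀⁻¹) 1 = 1 ∨ (σ * σ₀⁻¹) 1 = -1 := by
        have h3 : (σ * σ₀⁻¹) 1 ≠ 0 := typeB_ne_zero hBm one_ne_zero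
        by_contra hc
        have h4 := h1 ((σ * σ₀⁻¹) 1) (by rw [lt_abs]; omega)
        exact hc (Or.inl ((σ * σ₀⁻¹).injective h4))
      rw [← mul_inv_eq_one, ← mul_inv_eq_iff_eq_mul]
      have h5 := hBm.1 1
      have h6 := typeB_zero hBm
      refine h2.imp (fun h2 => ?_) (fun h2 => ?_) <;> ext z
      · by_cases hz : 1 < |z|
        · exact h1 z hz
        · have : z = 0 ∨ z = 1 ∨ z = -1 := by rw [lt_abs] at hz; omega
          rw [Perm.one_apply]
          rcases this with rfl | rfl | rfl
          exacts [h6, h2, by omega]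
      · by_cases hz : 1 < |z|
        · rw [h1 z hz, flipOne_of_one_lt hz]
        · have : z = 0 ∨ z = 1 ∨ z = -1 := by rw [lt_abs] at hz; omega
          rw [flipOne_apply]
          rcases this with rfl | rfl | rfl
          exacts [h6, h2, by rw [if_pos rfl]; omega]
    · rintro (rfl | rfl)
      · exact ⟨h₀, hb, fun _ _ => rfl⟩
      · refine ⟨typeB_mul (flipOne_mem_typeB hn) h₀, fun i hi => ?_, fun j hj => ?_⟩
        · rw [Perm.mul_apply, abs_flipOne]
          exact hb i hi
        · rw [mul_inv_rev, flipOne_inv, Perm.mul_apply, flipOne_of_one_lt (by exact_mod_cast hj)]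
  rw [h, Finset.card_pair]
  intro h1
  have h2 := Perm.congr_fun h1 (σ₀⁻¹ 1)
  rw [Perm.mul_apply, apply_inv_self, flipOne_apply] at h2
  simp at h2

/-- The moves are those of the sorting procedure itself, so each stage splits off one term `b_k` and
one letter of the cycle sets. The factor 2 counts the words of stage 1. -/
theorem Admissible.sum_sor {R : Type*} [CommSemiring R] (q : R) (t s : ℕ → R) {n : ℕ} {r : ℕ → ℕ}
    {σ₀ : Perm ℤ} (H : Admissible n r σ₀) (hn : 1 ≤ n) :
    ∑ σ ∈ stageFinset n r σ₀ n, q ^ relSorD n r σ σ₀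
        * (∏ i ∈ cyc0' n (σ * σ₀⁻¹), t i) * ∏ i ∈ cyc1' n (σ * σ₀⁻¹), s i =
      (∏ i ∈ Finset.Icc 2 n, (t i + (q + q ^ (2 * i - riseHeight n r i - 1))
          * qInt q (riseHeight n r i - 1) + q ^ (2 * i - 2) * s i)) * 2 := by
  have key := sum_stage_eq_prod H.mem (fun k l => signedSwap l (σ₀⁻¹ (k : ℤ)))
    (fun k σ => q ^ relSorAux n r σ₀ k σ
        * (∏ i ∈ cyc0' k (σ * σ₀⁻¹), t i) * ∏ i ∈ cyc1' k (σ * σ₀⁻¹), s i)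
    (fun k l => q ^ (if 0 < l then slotRank n r σ₀ k l.natAbs
        else 2 * k - 2 - slotRank n r σ₀ k l.natAbs) *
      (if l = σ₀⁻¹ (k : ℤ) then t k else 1) * (if l = -σ₀⁻¹ (k : ℤ) then s k else 1))
    (fun k hk hkn l hl => H.isMove_signedSwap (by omega) hkn hl) ?_ n hn le_rfl
  · rw [show (∑ σ ∈ stageFinset n r σ₀ n, q ^ relSorD n r σ σ₀
        * (∏ i ∈ cyc0' n (σ * σ₀⁻¹), t i) * ∏ i ∈ cyc1' n (σ * σ₀⁻¹), s i) = _ from key]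
    congr 1
    · refine Finset.prod_congr rfl fun k hk => ?_
      rw [Finset.mem_Icc] at hk
      rw [← sum_sor_weight q (t k) (s k) (H.riseHeight_pos (by omega) hk.2) (riseHeight_le n r k),
        ← H.sum_slots (by omega) hk.2]
      refine Finset.sum_congr rfl fun p hp => ?_
      have h1 := inv_natCast_mem_Icc H.mem H.pos (show 1 ≤ k by omega) hk.2
      have hp1 := mem_slots.mp hp
      have h2 := H.slotRank_eq_zero_iff (by omega) hk.2 hp
      simp only [h2]
      rw [if_pos (show 0 < (p : ℤ) by omega), if_neg (show ¬ 0 < -(p : ℤ) by omega),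
        Int.natAbs_neg, Int.natAbs_natCast, if_neg (show ¬ (p : ℤ) = -σ₀⁻¹ (k : ℤ) by omega),
        if_neg (show ¬ -(p : ℤ) = σ₀⁻¹ (k : ℤ) by omega)]
      by_cases h3 : σ₀⁻¹ (k : ℤ) = p
      · rw [if_pos h3, if_pos h3, if_pos h3.symm, if_pos (show -(p : ℤ) = -σ₀⁻¹ (k : ℤ) by rw [h3]), h2.mpr h3]
        simp
      · rw [if_neg h3, if_neg h3, if_neg (Ne.symm h3),
          if_neg (show ¬ -(p : ℤ) = -σ₀⁻¹ (k : ℤ) by omega)]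
        simp
    · simp only [relSorAux, cyc0'_one, cyc1'_one]
      simp [stageFinset_one hn H.mem H.bound]
  · intro k hk hkn l hl σ hσ
    have hM := H.isMove_signedSwap (by omega) hkn hl
    have hmem := hM.mul_inv_mem hσ
    have hm := inv_natCast_mem_Icc H.mem H.pos (show 1 ≤ k + 1 by omega) hkn
    have hl' := mem_slots.mp hl
    have hl0 : l ≠ 0 := by omega
    have hinv : (signedSwap l (σ₀⁻¹ ((k + 1 : ℕ) : ℤ)))⁻¹ =
      signedSwap l (σ₀⁻¹ ((k + 1 : ℕ) : ℤ)) := signedSwap_inv (by omega) hl0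
    simp only [hinv] at hmem ⊢
    rw [relSorAux_succ n r σ₀ _ hk, relSorTerm_eq, hmem.2, mul_assoc σ,
      signedSwap_mul_self (by omega) hl0, mul_one]
    -- Seen on letters, undoing a sorting step multiplies `σ * σ₀⁻¹` by the signed transposition of
    -- `σ₀ l` and `k + 1`, to which the insertion lemmas for cycles apply.
    have hconj : σ * signedSwap l (σ₀⁻¹ ((k + 1 : ℕ) : ℤ)) * σ₀⁻¹ =
        σ * σ₀⁻¹ * signedSwap (σ₀ l) ((k + 1 : ℕ) : ℤ) := by
      have := conj_signedSwap (typeB_inv H.mem) (σ₀ l) ((k + 1 : ℕ) : ℤ)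
      rw [inv_apply_self] at this
      rw [mul_assoc, ← this, mul_assoc]
    have hp : (σ * σ₀⁻¹) ((k + 1 : ℕ) : ℤ) = (k + 1 : ℕ) := by
      rw [Perm.mul_apply, ← hσ.2.2 _ (by rw [abs_of_nonneg] <;> omega), apply_inv_self]
    have hp' : (σ * σ₀⁻¹) (-((k + 1 : ℕ) : ℤ)) = -((k + 1 : ℕ) : ℤ) := by
      rw [(typeB_mul hσ.1 (typeB_inv H.mem)).1, hp]
    have hj0 : σ₀ l ≠ 0 := typeB_ne_zero H.mem hl0
    have hjk : |σ₀ l| ≤ ((k + 1 : ℕ) : ℤ) := by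
      rw [← typeB_apply_abs H.mem, ← Int.natCast_natAbs l,
        abs_of_pos (H.pos _ hl'.1.1 hl'.1.2)]
      exact hl'.2.2
    have e1 : l = σ₀⁻¹ ((k + 1 : ℕ) : ℤ) ↔ σ₀ l = (k + 1 : ℕ) := Perm.eq_inv_iff_eq
    have e2 : l = -σ₀⁻¹ ((k + 1 : ℕ) : ℤ) ↔ σ₀ l = -((k + 1 : ℕ) : ℤ) := by
      rw [← (typeB_inv H.mem).1]
      exact Perm.eq_inv_iff_eq
    have c0 : ∏ i ∈ cyc0' (k + 1) (σ * σ₀⁻¹ * signedSwap (σ₀ l) ((k + 1 : ℕ) : ℤ)), t i =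
        (if l = σ₀⁻¹ ((k + 1 : ℕ) : ℤ) then t (k + 1) else 1) * ∏ i ∈ cyc0' k (σ * σ₀⁻¹), t i := by
      simp only [e1]
      unfold cyc0'
      rw [cyc0_mul_signedSwap hp hp' hj0 hjk]
      split_ifs
      · rw [Finset.erase_insert_of_ne (by omega)]
        exact Finset.prod_insert (succ_notMem_cyc0' k _)
      · rw [one_mul]
    have c1 : ∏ i ∈ cyc1' (k + 1) (σ * σ₀⁻¹ * signedSwap (σ₀ l) ((k + 1 : ℕ) : ℤ)), s i =
        (if l = -σ₀⁻¹ ((k + 1 : ℕ) : ℤ) then s (k + 1) else 1) *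
          ∏ i ∈ cyc1' k (σ * σ₀⁻¹), s i := by
      simp only [e2]
      unfold cyc1'
      rw [cyc1_mul_signedSwap hp hp' hj0 hjk]
      split_ifs
      · rw [Finset.erase_insert_of_ne (by omega)]
        exact Finset.prod_insert (succ_notMem_cyc1' k _)
      · rw [one_mul]
    rw [hconj, c0, c1, pow_add]
    ring

/-! ### Inversions and right-to-left minima under insertion. -/

/-- The increasing map that misses `p`. -/
def skip (p i : ℕ) : ℕ := if i < p then i else i + 1

theorem sum_Icc_succ_skip {M : Type*} [AddCommMonoid M] {p k : ℕ} (hp : 1 ≤ p) (hpk : p ≤ k + 1)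
    (f : ℕ → M) :
    ∑ i ∈ Finset.Icc 1 (k + 1), f i = f p + ∑ i ∈ Finset.Icc 1 k, f (skip p i) := by
  have h : Finset.Icc 1 (k + 1) = insert p ((Finset.Icc 1 k).image (skip p)) := by
    ext x
    simp only [Finset.mem_insert, Finset.mem_image, Finset.mem_Icc]
    constructor
    · intro hx
      rcases lt_trichotomy x p with h | h | h
      · exact Or.inr ⟨x, by omega, if_pos h⟩
      · exact Or.inl h
      · exact Or.inr ⟨x - 1, by omega, by unfold skip; rw [if_neg] <;> omega⟩
    · rintro (rfl | ⟨i, hi, rfl⟩)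
      · omega
      · unfold skip; split_ifs <;> omega
  rw [h, Finset.sum_insert, Finset.sum_image]
  · intro a _ b _ hab
    unfold skip at hab
    split_ifs at hab <;> omega
  · simp only [Finset.mem_image, not_exists, not_and]
    intro i _ hi
    unfold skip at hi
    split_ifs at hi <;> omega

/-- The contribution of two letters to the type `D` inversion number. -/
def invPair (x y : ℤ) : ℕ := (if x > y then 1 else 0) + if -x > y then 1 else 0

theorem invD_eq_sum (n : ℕ) (σ : Perm ℤ) :
    invD n σ = ∑ i ∈ Finset.Icc 1 n, ∑ j ∈ Finset.Icc 1 n,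
      if i < j then invPair (σ i) (σ j) else 0 := by
  unfold invD
  rw [Finset.card_filter, Finset.card_filter, Finset.sum_product, Finset.sum_product,
    ← Finset.sum_add_distrib]
  refine Finset.sum_congr rfl fun i _ => ?_
  rw [← Finset.sum_add_distrib]
  refine Finset.sum_congr rfl fun j _ => ?_
  unfold invPair
  by_cases h : i < j <;> simp [h]

section

variable {k p : ℕ} {σ σ' : Perm ℤ}

/-- The letter at `p` dominates all others in absolute value. With each of the `k + 1 - p` letters
to its right it forms exactly one inversion, whatever its sign. With each of the `p - 1` letters to
its left it forms none if positive and two if negative. -/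
theorem invD_insert (hp : 1 ≤ p) (hpk : p ≤ k + 1)
    (hd : ∀ i ∈ Finset.Icc 1 k, σ (skip p i : ℕ) = σ' i)
    (hle : ∀ i ∈ Finset.Icc 1 k, |σ' (i : ℕ)| ≤ (k : ℤ))
    (hσ : σ p = (k + 1 : ℕ) ∨ σ p = -((k + 1 : ℕ) : ℤ)) :
    invD (k + 1) σ = (if 0 < σ p then k + 1 - p else 2 * (k + 1) - 2 - (k + 1 - p)) +
      invD k σ' := by
  rw [invD_eq_sum, invD_eq_sum]
  simp only [sum_Icc_succ_skip hp hpk]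
  rw [if_neg (lt_irrefl p), zero_add, Finset.sum_add_distrib, ← add_assoc]
  congr 1
  · have h1 : ∑ j ∈ Finset.Icc 1 k,
        (if p < skip p j then invPair (σ p) (σ (skip p j : ℕ)) else 0) = k + 1 - p := by
      have : ∀ j ∈ Finset.Icc 1 k,
          (if p < skip p j then invPair (σ p) (σ (skip p j : ℕ)) else 0) =
            if p ≤ j then 1 else 0 := by
        intro j hj
        rw [hd j hj]
        have h2 := abs_le.mp (hle j hj)
        have h3 : p < skip p j ↔ p ≤ j := by unfold skip; split_ifs <;> omega
        simp only [h3]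
        congr 1
        unfold invPair
        rcases hσ with h | h <;> rw [h] <;> split_ifs <;> omega
      rw [Finset.sum_congr rfl this, ← Finset.card_filter, ← Nat.card_Icc]
      congr 1
      ext j
      simp only [Finset.mem_filter, Finset.mem_Icc]
      omega
    have h2 : ∑ i ∈ Finset.Icc 1 k,
        (if skip p i < p then invPair (σ (skip p i : ℕ)) (σ p) else 0) =
          if 0 < σ p then 0 else 2 * (p - 1) := by
      have : ∀ i ∈ Finset.Icc 1 k,
          (if skip p i < p then invPair (σ (skip p i : ℕ)) (σ p) else 0) =
            (if 0 < σ p then 0 else 2) * if i < p then 1 else 0 := by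
        intro i hi
        rw [hd i hi]
        have h2 := abs_le.mp (hle i hi)
        have h3 : skip p i < p ↔ i < p := by unfold skip; split_ifs <;> omega
        simp only [h3]
        unfold invPair
        rcases hσ with h | h <;> rw [h] <;> split_ifs <;> omega
      rw [Finset.sum_congr rfl this, ← Finset.mul_sum, ← Finset.card_filter]
      have h4 : (Finset.Icc 1 k).filter (fun i => i < p) = Finset.Icc 1 (p - 1) := by
        ext j
        simp only [Finset.mem_filter, Finset.mem_Icc]
        omega
      rw [h4, Nat.card_Icc]
      split_ifs <;> omega
    rw [h1, h2]
    split_ifs <;> omega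
  · refine Finset.sum_congr rfl fun i hi => Finset.sum_congr rfl fun j hj => ?_
    rw [hd i hi, hd j hj]
    have h3 : skip p i < skip p j ↔ i < j := by unfold skip; split_ifs <;> omega
    simp only [h3]

theorem mem_prlminl' {n x : ℕ} : x ∈ prlminl' n σ ↔
    ∃ i : ℕ, (1 ≤ i ∧ i ≤ n) ∧ 1 < x ∧ σ (i : ℤ) = x ∧
      ∀ l : ℕ, i < l → l ≤ n → (x : ℤ) < |σ (l : ℤ)| := by
  simp only [prlminl', Finset.mem_image, Finset.mem_filter, Finset.mem_Icc, Finset.mem_Ioc]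
  constructor
  · rintro ⟨i, ⟨h1, h2, h3⟩, rfl⟩
    refine ⟨i, h1, by omega, by omega, fun l h4 h5 => ?_⟩
    have := h3 l ⟨h4, h5⟩
    omega
  · rintro ⟨i, h1, h2, h3, h4⟩
    refine ⟨i, ⟨h1, by omega, fun l hl => ?_⟩, by omega⟩
    rw [h3]
    exact h4 l hl.1 hl.2

/-- The inserted letter is too large to spoil the condition for any other letter, and satisfies it
only when positive and in last position. -/
theorem prlminl'_insert (hk : 1 ≤ k) (hp : 1 ≤ p) (hpk : p ≤ k + 1)
    (hd : ∀ i ∈ Finset.Icc 1 k, σ (skip p i : ℕ) = σ' i)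
    (hle : ∀ i ∈ Finset.Icc 1 k, |σ' (i : ℕ)| ≤ (k : ℤ))
    (hσ : σ p = (k + 1 : ℕ) ∨ σ p = -((k + 1 : ℕ) : ℤ)) :
    prlminl' (k + 1) σ = if p = k + 1 ∧ 0 < σ p then insert (k + 1) (prlminl' k σ')
      else prlminl' k σ' := by
  have hsp : |σ p| = (k + 1 : ℕ) := (abs_eq (by omega)).mpr hσ
  have hcover : ∀ l : ℕ, 1 ≤ l → l ≤ k + 1 → l = p ∨ ∃ i, (1 ≤ i ∧ i ≤ k) ∧ skip p i = l := by
    intro x _ _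
    rcases lt_trichotomy x p with h | h | h
    · exact Or.inr ⟨x, by omega, if_pos h⟩
    · exact Or.inl h
    · exact Or.inr ⟨x - 1, by omega, by unfold skip; rw [if_neg] <;> omega⟩
  have hskip : ∀ i j, skip p i < skip p j ↔ i < j := by
    intro i j; unfold skip; split_ifs <;> omega
  have hrange : ∀ i, 1 ≤ i → i ≤ k → 1 ≤ skip p i ∧ skip p i ≤ k + 1 := by
    intro i _ _; unfold skip; split_ifs <;> omega
  ext x
  have hL : x ∈ (if p = k + 1 ∧ 0 < σ p then insert (k + 1) (prlminl' k σ')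
      else prlminl' k σ') ↔ (x = k + 1 ∧ p = k + 1 ∧ 0 < σ p) ∨ x ∈ prlminl' k σ' := by
    split_ifs with h <;> try rw [Finset.mem_insert]
    all_goals tauto
  rw [hL, mem_prlminl', mem_prlminl']
  constructor
  · rintro ⟨i, hi, hx, hix, hmin⟩
    rcases hcover i hi.1 hi.2 with rfl | ⟨i, hi', rfl⟩
    · left
      have hxk : x = k + 1 := by omega
      refine ⟨hxk, ?_, by omega⟩
      by_contra hne
      have h1 := hmin (k + 1) (by omega) le_rfl
      have h2 := hd k (Finset.mem_Icc.mpr ⟨hk, le_rfl⟩)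
      have h3 := hle k (Finset.mem_Icc.mpr ⟨hk, le_rfl⟩)
      rw [show skip i k = k + 1 by unfold skip; rw [if_neg]; omega] at h2
      rw [h2] at h1
      omega
    · right
      rw [hd i (Finset.mem_Icc.mpr hi')] at hix
      refine ⟨i, hi', hx, hix, fun l h1 h2 => ?_⟩
      have := hmin (skip p l) ((hskip i l).mpr h1) (hrange l (by omega) h2).2
      rwa [hd l (Finset.mem_Icc.mpr ⟨by omega, h2⟩)] at this
  · rintro (⟨hx, rfl, hs⟩ | ⟨i, hi, hx, hix, hmin⟩)
    · exact ⟨k + 1, by omega, by omega, by omega, fun l h1 h2 => by omega⟩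
    · refine ⟨skip p i, hrange i hi.1 hi.2, hx, by rw [hd i (Finset.mem_Icc.mpr hi), hix],
        fun l h1 h2 => ?_⟩
      have h5 := (le_abs_self _).trans (hle i (Finset.mem_Icc.mpr hi))
      rcases hcover l (by omega) h2 with rfl | ⟨j, hj, rfl⟩
      · omega
      · rw [hd j (Finset.mem_Icc.mpr hj)]
        exact hmin j ((hskip i j).mp h1) hj.2

end

/-! ### Shifts as moves and the inversion generating function. -/

/-- The signed permutation of positions that moves the place `k` to `l` and shifts the places from
`|l|` to `k - 1` to the right. -/
def shiftPerm (k : ℕ) (l : ℤ) (h : 1 ≤ l.natAbs ∧ l.natAbs ≤ k) : Perm ℤ where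
  toFun x := if x = k then l else if x = -k then -l
    else if (l.natAbs : ℤ) ≤ x ∧ x < k then x + 1
    else if -(k : ℤ) < x ∧ x ≤ -(l.natAbs : ℤ) then x - 1 else x
  invFun y := if y = l then k else if y = -l then -k
    else if (l.natAbs : ℤ) < y ∧ y ≤ k then y - 1
    else if -(k : ℤ) ≤ y ∧ y < -(l.natAbs : ℤ) then y + 1 else y
  left_inv x := by
    simp only
    split_ifs <;> omega
  right_inv y := by
    simp only
    split_ifs <;> omega

theorem shiftPerm_apply {k : ℕ} {l : ℤ} (h : 1 ≤ l.natAbs ∧ l.natAbs ≤ k) (x : ℤ) :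
    shiftPerm k l h x = if x = k then l else if x = -k then -l
    else if (l.natAbs : ℤ) ≤ x ∧ x < k then x + 1
    else if -(k : ℤ) < x ∧ x ≤ -(l.natAbs : ℤ) then x - 1 else x := rfl

theorem shiftPerm_mem_typeB {n k : ℕ} {l : ℤ} (h : 1 ≤ l.natAbs ∧ l.natAbs ≤ k) (hkn : k ≤ n) :
    shiftPerm k l h ∈ typeB n := by
  refine ⟨fun x => ?_, fun x hx => ?_⟩
  · rw [shiftPerm_apply, shiftPerm_apply]
    split_ifs <;> omega
  · rw [lt_abs] at hx
    rw [shiftPerm_apply]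
    split_ifs <;> omega

theorem mem_slots_one {n : ℕ} {r : ℕ → ℕ} {k i : ℕ} :
    i ∈ slots n r 1 k ↔ (1 ≤ i ∧ i ≤ n) ∧ k ≤ r i ∧ i ≤ k := by
  rw [mem_slots, Perm.one_apply, Nat.cast_le]

theorem isMove_shiftPerm {n : ℕ} {r : ℕ → ℕ} {k : ℕ} {l : ℤ}
    (hmono : ∀ i j : ℕ, 1 ≤ i → i ≤ j → j ≤ n → r i ≤ r j) (hkn : k ≤ n)
    (h : 1 ≤ l.natAbs ∧ l.natAbs ≤ k) (hl : k ≤ r l.natAbs) :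
    IsMove n r 1 k l (shiftPerm k l h) := by
  refine ⟨shiftPerm_mem_typeB h hkn, ?_, ?_, ?_⟩
  · rw [inv_one, Perm.one_apply, shiftPerm_apply, if_pos rfl]
  · intro j hj
    rw [lt_abs] at hj
    rw [inv_one, Perm.one_apply, shiftPerm_apply]
    split_ifs <;> omega
  · intro i hi hne
    rw [Finset.mem_Icc] at hi
    -- Every moved position lies at or to the right of `|l|`, so monotonicity of `r` transports the
    -- bound.
    refine hl.trans (hmono _ _ h.1 ?_ hi.2)
    rw [shiftPerm_apply] at hne
    split_ifs at hne <;> omega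

theorem slotRank_one {n : ℕ} {r : ℕ → ℕ} {k p : ℕ} (hp : 1 ≤ p) (hpk : p ≤ k) (hkn : k ≤ n) :
    slotRank n r 1 k p = k - p := by
  unfold slotRank cyclicBetween
  simp only [inv_one, Perm.one_apply, Nat.cast_le, Nat.cast_lt]
  rw [if_pos hpk, ← Nat.card_Ico]
  congr 1
  ext i
  simp only [Finset.mem_filter, Finset.mem_Icc, Finset.mem_Ico]
  omega

theorem admissible_one {n : ℕ} {r : ℕ → ℕ}
    (hmono : ∀ i j : ℕ, 1 ≤ i → i ≤ j → j ≤ n → r i ≤ r j)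
    (hr : ∀ k : ℕ, 1 ≤ k → k ≤ n → k ≤ r k) : Admissible n r 1 where
  mono := hmono
  mem := typeB_one n
  pos k hk _ := by rw [Perm.one_apply]; omega
  bound i hi := by
    rw [Finset.mem_Icc] at hi
    have := hr i hi.1 hi.2
    rw [Perm.one_apply, abs_of_nonneg] <;> omega

theorem succ_notMem_prlminl' (k : ℕ) {σ : Perm ℤ}
    (hle : ∀ i ∈ Finset.Icc 1 k, |σ (i : ℕ)| ≤ (k : ℤ)) : k + 1 ∉ prlminl' k σ := by
  rw [mem_prlminl']
  rintro ⟨i, hi, -, hix, -⟩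
  have := (le_abs_self _).trans (hle i (Finset.mem_Icc.mpr hi))
  omega

/-- All integers beyond `k` are fixed, so the word is a signed permutation of size `k`. -/
theorem abs_le_of_mem_stage_one {n : ℕ} {r : ℕ → ℕ} {k : ℕ} {σ : Perm ℤ}
    (hσ : σ ∈ stage n r 1 k) : ∀ i ∈ Finset.Icc 1 k, |σ (i : ℕ)| ≤ (k : ℤ) := by
  intro i hi
  rw [Finset.mem_Icc] at hi
  refine typeB_abs_le (n := k) ⟨hσ.1.1, fun x hx => ?_⟩ (by rw [abs_of_nonneg] <;> omega)
  have := hσ.2.2 x hx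
  rw [inv_one, Perm.one_apply, Perm.inv_eq_iff_eq] at this
  exact this.symm

theorem invD_one (σ : Perm ℤ) : invD 1 σ = 0 := by
  simp [invD_eq_sum]

theorem prlminl'_one {σ : Perm ℤ} (h : |σ 1| ≤ 1) : prlminl' 1 σ = ∅ := by
  ext x
  rw [mem_prlminl']
  simp only [Finset.notMem_empty, iff_false]
  rintro ⟨i, hi, hx, hix, -⟩
  obtain rfl : i = 1 := by omega
  rw [Nat.cast_one] at hix
  rw [hix, abs_of_nonneg] at h <;> omega

theorem sum_inv {R : Type*} [CommSemiring R] (q : R) (t : ℕ → R) {n : ℕ} {r : ℕ → ℕ}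
    (H : Admissible n r 1) (hn : 1 ≤ n) :
    ∑ σ ∈ stageFinset n r 1 n, q ^ invD n σ * ∏ i ∈ prlminl' n σ, t i =
      (∏ i ∈ Finset.Icc 2 n, (t i + q * qInt q (riseHeight n r i - 1)
          + q ^ (2 * i - riseHeight n r i - 1) * qInt q (riseHeight n r i))) * 2 := by
  have key := sum_stage_eq_prod (r := r) H.mem
    -- The default `1` is never used: for `σ₀ = 1` every slot of `k` is between `1` and `k`.
    (fun k l => if h : 1 ≤ l.natAbs ∧ l.natAbs ≤ k then shiftPerm k l h else 1)
    (fun k σ => q ^ invD k σ * ∏ i ∈ prlminl' k σ, t i)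
    (fun k l => q ^ (if 0 < l then k - l.natAbs else 2 * k - 2 - (k - l.natAbs)) *
      (if l = k then t k else 1)) ?_ ?_ n hn le_rfl
  · rw [key]
    congr 1
    · refine Finset.prod_congr rfl fun k hk => ?_
      rw [Finset.mem_Icc] at hk
      rw [← sum_inv_weight q (t k) (H.riseHeight_pos (by omega) hk.2) (riseHeight_le n r k),
        ← H.sum_slots (by omega) hk.2]
      refine Finset.sum_congr rfl fun p hp => ?_
      rw [mem_slots_one] at hp
      rw [slotRank_one hp.1.1 hp.2.2 hk.2, if_pos (show 0 < (p : ℤ) by omega),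
        if_neg (show ¬ 0 < -(p : ℤ) by omega), if_neg (show ¬ -(p : ℤ) = k by omega),
        Int.natAbs_neg, Int.natAbs_natCast, mul_one]
      congr 1
      by_cases h3 : p = k
      · rw [if_pos (by rw [h3]), if_pos (by omega), h3, Nat.sub_self, pow_zero, one_mul]
      · rw [if_neg (by omega), if_neg (by omega), mul_one]
    · rw [Finset.sum_congr rfl (g := fun _ => 1)]
      · simp [stageFinset_one hn H.mem H.bound]
      · intro σ hσ
        have h1 := abs_le_of_mem_stage_one (mem_stageFinset.mp hσ) 1 (by simp)
        rw [invD_one, prlminl'_one (by exact_mod_cast h1), pow_zero, Finset.prod_empty, one_mul]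
  · intro k hk hkn l hl
    rw [mem_slots_one] at hl
    rw [dif_pos ⟨hl.1.1, hl.2.2⟩]
    exact isMove_shiftPerm H.mono hkn _ hl.2.1
  · intro k hk hkn l hl σ hσ
    rw [mem_slots_one] at hl
    have hl' : 1 ≤ l.natAbs ∧ l.natAbs ≤ k + 1 := ⟨hl.1.1, hl.2.2⟩
    rw [dif_pos hl']
    have hle := abs_le_of_mem_stage_one hσ
    set π := σ * (shiftPerm (k + 1) l hl')⁻¹ with hπ
    have hπg : ∀ x, π (shiftPerm (k + 1) l hl' x) = σ x := by
      intro x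
      rw [hπ, Perm.mul_apply, inv_apply_self]
    have hd : ∀ i ∈ Finset.Icc 1 k, π (skip l.natAbs i : ℕ) = σ i := by
      intro i hi
      rw [Finset.mem_Icc] at hi
      rw [← hπg i, shiftPerm_apply]
      congr 1
      unfold skip
      split_ifs <;> omega
    have hK : σ ((k + 1 : ℕ) : ℤ) = ((k + 1 : ℕ) : ℤ) := by
      have := hσ.2.2 ((k + 1 : ℕ) : ℤ) (by rw [abs_of_nonneg] <;> omega)
      rw [inv_one, Perm.one_apply, Perm.inv_eq_iff_eq] at this
      exact this.symm
    have hpos : 0 < l → π (l.natAbs : ℤ) = ((k + 1 : ℕ) : ℤ) := by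
      intro h
      rw [← hK, ← hπg, shiftPerm_apply, if_pos rfl]
      congr 1
      omega
    have hneg : ¬ 0 < l → π (l.natAbs : ℤ) = -((k + 1 : ℕ) : ℤ) := by
      intro h
      rw [← hK, ← hσ.1.1, ← hπg, shiftPerm_apply, if_neg (by omega), if_pos rfl]
      congr 1
      omega
    have hiff : 0 < π (l.natAbs : ℤ) ↔ 0 < l := by
      by_cases h : 0 < l
      · rw [hpos h]; omega
      · rw [hneg h]; omega
    have hcases : π (l.natAbs : ℤ) = ((k + 1 : ℕ) : ℤ) ∨ π (l.natAbs : ℤ) = -((k + 1 : ℕ) : ℤ) := by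
      by_cases h : 0 < l
      exacts [Or.inl (hpos h), Or.inr (hneg h)]
    rw [invD_insert hl'.1 hl'.2 hd hle hcases, prlminl'_insert hk hl'.1 hl'.2 hd hle hcases]
    simp only [hiff]
    have hlk : (l.natAbs = k + 1 ∧ 0 < l) ↔ l = ((k + 1 : ℕ) : ℤ) := by omega
    simp only [hlk]
    by_cases h : l = ((k + 1 : ℕ) : ℤ)
    · rw [if_pos h, if_pos h, Finset.prod_insert (succ_notMem_prlminl' k hle), pow_add]
      ring
    · rw [if_neg h, if_neg h, pow_add]
      ring

/-! ### Parity of minus signs: from all signed words to type D. -/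

/-- The product of the signs of the entries of a word. -/
def signProd (n : ℕ) (σ : Perm ℤ) : ℤ := ∏ k ∈ Finset.Icc 1 n, (σ (k : ℕ)).sign

theorem signProd_eq {n : ℕ} {σ : Perm ℤ} (hσ : σ ∈ typeB n) :
    signProd n σ = (-1) ^ negCount n σ := by
  unfold signProd negCount
  rw [← Finset.prod_const, Finset.prod_filter]
  refine Finset.prod_congr rfl fun k hk => ?_
  rw [Finset.mem_Icc] at hk
  have h0 : σ (k : ℤ) ≠ 0 := typeB_ne_zero hσ (by omega)
  split_ifs with h
  · exact Int.sign_eq_neg_one_of_neg h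
  · exact Int.sign_eq_one_of_pos (by omega)

theorem mem_typeD_iff {n : ℕ} {σ : Perm ℤ} (hσ : σ ∈ typeB n) :
    σ ∈ typeD n ↔ signProd n σ = 1 := by
  rw [signProd_eq hσ, neg_one_pow_eq_one_iff_even (by decide)]
  exact ⟨fun h => h.2, fun h => ⟨hσ, h⟩⟩

/-- The sign of `σ (g k)` is that of `g k` times that of `σ |g k|`, and `k ↦ |g k|` permutes `1, …,
n`. -/
theorem signProd_mul {n : ℕ} {σ g : Perm ℤ} (hσ : σ ∈ typeB n) (hg : g ∈ typeB n) :
    signProd n (σ * g) = signProd n σ * signProd n g := by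
  have hmaps : ∀ {g : Perm ℤ}, g ∈ typeB n → ∀ k ∈ Finset.Icc 1 n,
      (g (k : ℕ)).natAbs ∈ Finset.Icc 1 n := by
    intro g hg k hk
    rw [Finset.mem_Icc] at hk ⊢
    have h0 : g (k : ℤ) ≠ 0 := typeB_ne_zero hg (by omega)
    have h1 := typeB_abs_le hg (x := (k : ℤ)) (by rw [abs_of_nonneg] <;> omega)
    rw [abs_le] at h1
    omega
  have hinv : ∀ {g h : Perm ℤ}, g ∈ typeB n → h ∈ typeB n → (∀ x, h (g x) = x) →
      ∀ k ∈ Finset.Icc 1 n, (h ((g (k : ℕ)).natAbs : ℤ)).natAbs = k := by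
    intro g h hg hh hgh k hk
    rcases Int.natAbs_eq (g (k : ℤ)) with h1 | h1
    · rw [← h1, hgh, Int.natAbs_natCast]
    · rw [show ((g (k : ℤ)).natAbs : ℤ) = -g (k : ℤ) by omega, hh.1, hgh, Int.natAbs_neg,
        Int.natAbs_natCast]
  have h1 : ∏ k ∈ Finset.Icc 1 n, (σ ((g (k : ℕ)).natAbs : ℤ)).sign = signProd n σ := by
    refine Finset.prod_nbij' (fun k : ℕ => (g (k : ℤ)).natAbs) (fun k : ℕ => (g⁻¹ (k : ℤ)).natAbs)
      (hmaps hg) (hmaps (typeB_inv hg)) (hinv hg (typeB_inv hg) (inv_apply_self g))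
      (hinv (typeB_inv hg) hg (apply_inv_self g)) fun _ _ => rfl
  rw [← h1]
  unfold signProd
  rw [← Finset.prod_mul_distrib]
  refine Finset.prod_congr rfl fun k hk => ?_
  rw [Finset.mem_Icc] at hk
  have h0 : g (k : ℤ) ≠ 0 := typeB_ne_zero hg (by omega)
  rw [Perm.mul_apply]
  rcases lt_or_gt_of_ne h0 with h | h
  · rw [Int.sign_eq_neg_one_of_neg h, show ((g (k : ℤ)).natAbs : ℤ) = -g (k : ℤ) by omega, hσ.1,
      Int.sign_neg]
    ring
  · rw [Int.sign_eq_one_of_pos h, show ((g (k : ℤ)).natAbs : ℤ) = g (k : ℤ) by omega, mul_one]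

theorem signProd_one (n : ℕ) : signProd n 1 = 1 := by
  refine Finset.prod_eq_one fun k hk => ?_
  rw [Finset.mem_Icc] at hk
  exact Int.sign_eq_one_of_pos (by rw [Perm.one_apply]; omega)

theorem signProd_flip {n j : ℕ} (hj : 1 ≤ j) (hjn : j ≤ n) :
    signProd n (signedSwap (-j) j) = -1 := by
  unfold signProd
  rw [Finset.prod_eq_single j]
  · rw [signedSwap_apply (by omega) (by omega), if_pos rfl]
    exact Int.sign_eq_neg_one_of_neg (by omega)
  · intro b hb hbj
    rw [Finset.mem_Icc] at hb
    rw [signedSwap_apply (by omega) (by omega)]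
    refine Int.sign_eq_one_of_pos ?_
    split_ifs <;> omega
  · intro h
    exact absurd (Finset.mem_Icc.mpr ⟨hj, hjn⟩) h

theorem flipOne_eq : flipOne = signedSwap (-1) 1 := by
  unfold flipOne signedSwap
  rw [if_pos rfl]

theorem signProd_flipOne {n : ℕ} (hn : 1 ≤ n) : signProd n flipOne = -1 := by
  rw [flipOne_eq]
  exact signProd_flip le_rfl hn

theorem mem_restrictedD {n : ℕ} {r : ℕ → ℕ} {σ : Perm ℤ} : σ ∈ restrictedD n r ↔
    (σ ∈ typeB n ∧ ∀ i ∈ Finset.Icc 1 n, |σ (i : ℕ)| ≤ (r i : ℤ)) ∧ signProd n σ = 1 := by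
  simp only [restrictedD, Set.Finite.mem_toFinset]
  constructor
  · rintro ⟨h1, h2⟩
    exact ⟨⟨h1.1, h2⟩, (mem_typeD_iff h1.1).mp h1⟩
  · rintro ⟨⟨h1, h2⟩, h3⟩
    exact ⟨(mem_typeD_iff h1).mpr h3, h2⟩

theorem mem_stageFinset_top {n : ℕ} {r : ℕ → ℕ} {σ₀ σ : Perm ℤ} (h₀ : σ₀ ∈ typeB n) :
    σ ∈ stageFinset n r σ₀ n ↔
      σ ∈ typeB n ∧ ∀ i ∈ Finset.Icc 1 n, |σ (i : ℕ)| ≤ (r i : ℤ) := by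
  rw [mem_stageFinset]
  refine ⟨fun h => ⟨h.1, h.2.1⟩, fun h => ⟨h.1, h.2, fun j hj => ?_⟩⟩
  rw [(typeB_inv h.1).2 j hj, (typeB_inv h₀).2 j hj]

/-- Left multiplication by `flipOne` exchanges the bounded words of type D with those not of type D.
-/
theorem sum_stage_top {M : Type*} [AddCommMonoid M] {n : ℕ} {r : ℕ → ℕ} {σ₀ : Perm ℤ}
    (hn : 1 ≤ n) (h₀ : σ₀ ∈ typeB n) (F : Perm ℤ → M)
    (hF : ∀ σ ∈ typeB n, F (flipOne * σ) = F σ) :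
    ∑ σ ∈ stageFinset n r σ₀ n, F σ =
      ∑ σ ∈ restrictedD n r, F σ + ∑ σ ∈ restrictedD n r, F σ := by
  rw [← Finset.sum_filter_add_sum_filter_not _ (fun σ => signProd n σ = 1)]
  have h1 : (stageFinset n r σ₀ n).filter (fun σ => signProd n σ = 1) = restrictedD n r := by
    ext σ
    rw [Finset.mem_filter, mem_stageFinset_top h₀, mem_restrictedD]
  rw [h1]
  congr 1
  have hflip : ∀ σ, flipOne * (flipOne * σ) = σ := by
    intro σ
    rw [← mul_assoc, flipOne_mul_self, one_mul]
  refine Finset.sum_nbij' (fun σ => flipOne * σ) (fun σ => flipOne * σ) ?_ ?_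
    (fun σ _ => hflip σ) (fun σ _ => hflip σ) ?_
  · intro σ hσ
    rw [Finset.mem_filter, mem_stageFinset_top h₀] at hσ
    rw [mem_restrictedD, signProd_mul (flipOne_mem_typeB hn) hσ.1.1, signProd_flipOne hn]
    refine ⟨⟨typeB_mul (flipOne_mem_typeB hn) hσ.1.1, fun i hi => ?_⟩, ?_⟩
    · rw [Perm.mul_apply, abs_flipOne]
      exact hσ.1.2 i hi
    · have h2 := signProd_eq hσ.1.1
      rcases neg_one_pow_eq_or ℤ (negCount n σ) with h3 | h3
      · exact absurd (h2.trans h3) hσ.2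
      · rw [h2, h3]; rfl
  · intro σ hσ
    rw [mem_restrictedD] at hσ
    rw [Finset.mem_filter, mem_stageFinset_top h₀, signProd_mul (flipOne_mem_typeB hn) hσ.1.1,
      signProd_flipOne hn, hσ.2]
    refine ⟨⟨typeB_mul (flipOne_mem_typeB hn) hσ.1.1, fun i hi => ?_⟩, by decide⟩
    rw [Perm.mul_apply, abs_flipOne]
    exact hσ.1.2 i hi
  · intro σ hσ
    rw [Finset.mem_filter, mem_stageFinset_top h₀] at hσ
    exact (hF σ hσ.1.1).symm

/-! ### Invariance of the statistics under the sign change of the letter 1. -/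

/-- `invPair` is even in its first letter, and replacing a second letter `1` by `-1` changes no
comparison with letters of absolute value at least 2. -/
theorem invD_flipOne_mul {n : ℕ} {σ : Perm ℤ} (hσ : σ ∈ typeB n) :
    invD n (flipOne * σ) = invD n σ := by
  rw [invD_eq_sum, invD_eq_sum]
  refine Finset.sum_congr rfl fun i hi => Finset.sum_congr rfl fun j hj => ?_
  rw [Finset.mem_Icc] at hi hj
  split_ifs with h
  · have h1 : σ (i : ℤ) ≠ σ (j : ℤ) := fun e => by
      have := σ.injective e
      omega
    have h2 : σ (i : ℤ) ≠ -σ (j : ℤ) := fun e => by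
      rw [← hσ.1] at e
      have := σ.injective e
      omega
    have h3 : σ (i : ℤ) ≠ 0 := typeB_ne_zero hσ (by omega)
    have h4 : σ (j : ℤ) ≠ 0 := typeB_ne_zero hσ (by omega)
    unfold invPair
    rw [Perm.mul_apply, Perm.mul_apply, flipOne_apply, flipOne_apply]
    generalize σ (i : ℤ) = x at *
    generalize σ (j : ℤ) = y at *
    split_ifs <;> omega
  · rfl

theorem prlminl'_flipOne_mul (n : ℕ) (σ : Perm ℤ) :
    prlminl' n (flipOne * σ) = prlminl' n σ := by
  ext x
  simp only [mem_prlminl', Perm.mul_apply, abs_flipOne]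
  refine exists_congr fun i => and_congr_right fun _ => and_congr_right fun hx =>
    and_congr_left fun _ => ?_
  rw [flipOne_apply]
  generalize σ (i : ℤ) = y
  split_ifs with h1 h2 <;> constructor <;> intro h <;> first | exact h.elim | omega

theorem relSorAux_flipOne_mul (n : ℕ) (r : ℕ → ℕ) (σ₀ : Perm ℤ) (k : ℕ) (σ : Perm ℤ) :
    relSorAux n r σ₀ k (flipOne * σ) = relSorAux n r σ₀ k σ := by
  induction k generalizing σ with
  | zero => rfl
  | succ k ih =>
    rcases Nat.eq_zero_or_pos k with rfl | hk
    · rfl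
    have h : (flipOne * σ)⁻¹ ((k + 1 : ℕ) : ℤ) = σ⁻¹ ((k + 1 : ℕ) : ℤ) := by
      rw [mul_inv_rev, flipOne_inv, Perm.mul_apply,
        flipOne_of_one_lt (by rw [abs_of_nonneg] <;> omega)]
    rw [relSorAux_succ _ _ _ _ hk, relSorAux_succ _ _ _ _ hk, relSorTerm_eq, relSorTerm_eq, h,
      mul_assoc, ih]

theorem zpow_mul_apply_of_fixed {τ π : Perm ℤ} {x : ℤ} (h : ∀ m, π.SameCycle x m → τ m = m)
    (i : ℤ) : ((τ * π) ^ i) x = (π ^ i) x := by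
  induction i with
  | zero => rfl
  | succ i ih =>
    rw [add_comm, zpow_add, zpow_add, Perm.mul_apply, Perm.mul_apply, ih, zpow_one, zpow_one,
      Perm.mul_apply]
    exact h _ ⟨1 + i, by rw [zpow_add, zpow_one, Perm.mul_apply]⟩
  | pred i ih =>
    rw [sub_eq_neg_add, zpow_add, zpow_add, Perm.mul_apply, Perm.mul_apply, ih, zpow_neg_one,
      zpow_neg_one, mul_inv_rev, Perm.mul_apply]
    congr 1
    rw [Perm.inv_eq_iff_eq]
    exact (h _ ⟨_, rfl⟩).symm

/-- A cycle with minimal absolute value at least 2 avoids `±1`, so `flipOne` acts trivially on it.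
Only cycles through `±1` can change. -/
theorem sameCycle_flipOne_mul {π : Perm ℤ} {k : ℕ} (hk : 2 ≤ k)
    (h : ∀ m : ℤ, π.SameCycle (k : ℤ) m → (k : ℤ) ≤ |m|) (m : ℤ) :
    (flipOne * π).SameCycle (k : ℤ) m ↔ π.SameCycle (k : ℤ) m := by
  have hfix : ∀ m, π.SameCycle (k : ℤ) m → flipOne m = m := by
    intro m hm
    have := h m hm
    exact flipOne_of_one_lt (by omega)
  exact exists_congr fun i => by rw [zpow_mul_apply_of_fixed hfix]

theorem minimal_flipOne_mul {π : Perm ℤ} {k : ℕ} (hk : 2 ≤ k) :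
    (∀ m : ℤ, (flipOne * π).SameCycle (k : ℤ) m → (k : ℤ) ≤ |m|) ↔
      ∀ m : ℤ, π.SameCycle (k : ℤ) m → (k : ℤ) ≤ |m| := by
  have key : ∀ π : Perm ℤ, (∀ m : ℤ, π.SameCycle (k : ℤ) m → (k : ℤ) ≤ |m|) →
      ∀ m : ℤ, (flipOne * π).SameCycle (k : ℤ) m → (k : ℤ) ≤ |m| := fun π h m hm =>
    h m ((sameCycle_flipOne_mul hk h m).mp hm)
  refine ⟨fun h => ?_, key π⟩
  have := key _ h
  rwa [← mul_assoc, flipOne_mul_self, one_mul] at this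

theorem cyc0'_flipOne_mul (n : ℕ) (π : Perm ℤ) : cyc0' n (flipOne * π) = cyc0' n π := by
  ext k
  simp only [cyc0', cyc0, Finset.mem_erase, Finset.mem_filter, Finset.mem_Icc]
  refine and_congr_right fun h1 => and_congr_right fun h2 => ?_
  rw [minimal_flipOne_mul (by omega)]
  exact and_congr_right fun h3 => not_congr (sameCycle_flipOne_mul (by omega) h3 _)

theorem cyc1'_flipOne_mul (n : ℕ) (π : Perm ℤ) : cyc1' n (flipOne * π) = cyc1' n π := by
  ext k
  simp only [cyc1', cyc1, Finset.mem_erase, Finset.mem_filter, Finset.mem_Icc]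
  refine and_congr_right fun h1 => and_congr_right fun h2 => ?_
  rw [minimal_flipOne_mul (by omega)]
  exact and_congr_right fun h3 => sameCycle_flipOne_mul (by omega) h3 _

/-! ### Multisets from polynomials, and the sums over type D. -/

/-- The weight of a pair `(a, A)` as a monomial. -/
noncomputable def pairExponent (b : ℕ × Finset ℕ) : Option ℕ →₀ ℕ :=
  Finsupp.single none b.1 + ∑ i ∈ b.2, Finsupp.single (some i) 1

theorem pairExponent_none (b : ℕ × Finset ℕ) : pairExponent b none = b.1 := by
  simp [pairExponent]

theorem pairExponent_some (b : ℕ × Finset ℕ) (i : ℕ) :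
    pairExponent b (some i) = if i ∈ b.2 then 1 else 0 := by
  classical
  simp [pairExponent, Finsupp.single_apply]

theorem pairExponent_injective : Function.Injective pairExponent := by
  intro b c h
  refine Prod.ext ?_ ?_
  · rw [← pairExponent_none, h, pairExponent_none]
  · ext i
    have := DFunLike.congr_fun h (some i)
    rw [pairExponent_some, pairExponent_some] at this
    split_ifs at this <;> simp_all

theorem monomial_pairExponent (b : ℕ × Finset ℕ) :
    (MvPolynomial.X none ^ b.1 * ∏ i ∈ b.2, MvPolynomial.X (some i) : MvPolynomial (Option ℕ) ℕ) =
      MvPolynomial.monomial (pairExponent b) 1 := by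
  rw [pairExponent, MvPolynomial.X_pow_eq_monomial]
  simp only [MvPolynomial.X]
  rw [← MvPolynomial.monomial_sum_one, MvPolynomial.monomial_mul, one_mul]

/-- Distinct pairs give distinct monomials, so each coefficient is the multiplicity of a pair. -/
theorem map_eq_map_of_sum_eq {α : Type*} (S : Finset α) (f g : α → ℕ × Finset ℕ)
    (h : ∑ a ∈ S, (MvPolynomial.X none ^ (f a).1 * ∏ i ∈ (f a).2, MvPolynomial.X (some i) :
        MvPolynomial (Option ℕ) ℕ) =
      ∑ a ∈ S, (MvPolynomial.X none ^ (g a).1 * ∏ i ∈ (g a).2, MvPolynomial.X (some i))) :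
    S.val.map f = S.val.map g := by
  classical
  simp only [monomial_pairExponent] at h
  ext b
  have h1 := congrArg (MvPolynomial.coeff (pairExponent b)) h
  simp only [MvPolynomial.coeff_sum, MvPolynomial.coeff_monomial,
    pairExponent_injective.eq_iff] at h1
  rw [← Finset.card_filter, ← Finset.card_filter] at h1
  rw [Multiset.count_map, Multiset.count_map]
  simp only [eq_comm (a := b)]
  exact h1

/-- Halving is legitimate on coefficients in `ℕ`, but not in an arbitrary `R`. The generating
functions are therefore proved for indeterminates first. -/
theorem add_self_injective {ι : Type*} {a b : MvPolynomial ι ℕ} (h : a + a = b * 2) : a = b := by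
  ext m
  have := congrArg (MvPolynomial.coeff m) h
  rw [mul_two, MvPolynomial.coeff_add, MvPolynomial.coeff_add] at this
  omega

theorem map_qInt {R S : Type*} [CommSemiring R] [CommSemiring S] (φ : R →+* S) (q : R) (m : ℕ) :
    φ (qInt q m) = qInt (φ q) m := by
  simp [qInt, map_sum]

section

variable {R : Type*} [CommSemiring R] (q : R) (t s : ℕ → R) {n : ℕ} {r : ℕ → ℕ}

theorem restrictedD_zero (r : ℕ → ℕ) : restrictedD 0 r = {1} := by
  ext σ
  rw [mem_restrictedD, Finset.mem_singleton]
  constructor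
  · rintro ⟨⟨h, -⟩, -⟩
    ext x
    by_cases hx : x = 0
    · rw [hx, typeB_zero h, Perm.one_apply]
    · exact h.2 x (by simpa using hx)
  · rintro rfl
    exact ⟨⟨typeB_one 0, by simp⟩, signProd_one 0⟩

theorem restricted_sum_inv (H : Admissible n r 1) :
    ∑ σ ∈ restrictedD n r, q ^ invD n σ * ∏ i ∈ prlminl' n σ, t i =
      ∏ i ∈ Finset.Icc 2 n, (t i + q * qInt q (riseHeight n r i - 1)
          + q ^ (2 * i - riseHeight n r i - 1) * qInt q (riseHeight n r i)) := by
  rcases Nat.eq_zero_or_pos n with rfl | hn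
  · rw [restrictedD_zero]
    simp [invD, prlminl']
  have h := sum_inv (MvPolynomial.X none : MvPolynomial (Option ℕ) ℕ)
    (fun i => MvPolynomial.X (some i)) H hn
  rw [sum_stage_top hn H.mem _ fun σ hσ => by
    rw [invD_flipOne_mul hσ, prlminl'_flipOne_mul]] at h
  have h1 := congrArg (MvPolynomial.eval₂Hom (Nat.castRingHom R)
    (fun o : Option ℕ => o.elim q t)) (add_self_injective h)
  simpa only [map_sum, map_prod, map_mul, map_pow, map_add, map_qInt, MvPolynomial.eval₂Hom_X',
    Option.elim] using h1

theorem Admissible.restricted_sum_sor {σ₀ : Perm ℤ} (H : Admissible n r σ₀) :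
    ∑ σ ∈ restrictedD n r, q ^ relSorD n r σ σ₀
        * (∏ i ∈ cyc0' n (σ * σ₀⁻¹), t i) * ∏ i ∈ cyc1' n (σ * σ₀⁻¹), s i =
      ∏ i ∈ Finset.Icc 2 n, (t i + (q + q ^ (2 * i - riseHeight n r i - 1))
          * qInt q (riseHeight n r i - 1) + q ^ (2 * i - 2) * s i) := by
  rcases Nat.eq_zero_or_pos n with rfl | hn
  · rw [restrictedD_zero]
    simp [relSorD, relSorAux, cyc0', cyc1', cyc0, cyc1]
  have h := H.sum_sor (MvPolynomial.X none : MvPolynomial (Option (ℕ ⊕ ℕ)) ℕ)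
    (fun i => MvPolynomial.X (some (Sum.inl i))) (fun i => MvPolynomial.X (some (Sum.inr i))) hn
  rw [sum_stage_top hn H.mem _ fun σ hσ => by
    rw [mul_assoc flipOne, cyc0'_flipOne_mul, cyc1'_flipOne_mul]
    unfold relSorD
    rw [relSorAux_flipOne_mul]] at h
  have h1 := congrArg (MvPolynomial.eval₂Hom (Nat.castRingHom R)
    (fun o : Option (ℕ ⊕ ℕ) => o.elim q (Sum.elim t s))) (add_self_injective h)
  simpa only [map_sum, map_prod, map_mul, map_pow, map_add, map_qInt, MvPolynomial.eval₂Hom_X',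
    Option.elim, Sum.elim_inl, Sum.elim_inr] using h1

theorem Admissible.restricted_sum_sor_eq {σ₀ : Perm ℤ} (H : Admissible n r σ₀)
    (H₁ : Admissible n r 1) :
    ∑ σ ∈ restrictedD n r, q ^ relSorD n r σ σ₀ * ∏ i ∈ cyc0' n (σ * σ₀⁻¹), t i =
      ∑ σ ∈ restrictedD n r, q ^ invD n σ * ∏ i ∈ prlminl' n σ, t i := by
  have h := H.restricted_sum_sor q t (fun _ => 1)
  simp only [Finset.prod_const_one, mul_one] at h
  rw [h, restricted_sum_inv q t H₁]
  refine Finset.prod_congr rfl fun i hi => ?_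
  rw [Finset.mem_Icc] at hi
  have h1 := H.riseHeight_pos (show 1 ≤ i by omega) hi.2
  have h2 := riseHeight_le n r i
  -- With `s = 1`, the term `q ^ (2 * i - 2)` is the top power missing from `q ^ (2 * i - h - 1) *
  -- [h - 1]`.
  have h3 : qInt q (riseHeight n r i) =
      qInt q (riseHeight n r i - 1) + q ^ (riseHeight n r i - 1) := by
    unfold qInt
    rw [← Finset.sum_range_succ, Nat.sub_add_cancel h1]
  have h4 : q ^ (2 * i - 2) =
      q ^ (2 * i - riseHeight n r i - 1) * q ^ (riseHeight n r i - 1) := by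
    rw [← pow_add]
    congr 1
    omega
  rw [h3, h4]
  ring

end

theorem Admissible.map_sor_eq_map_inv {n : ℕ} {r : ℕ → ℕ} {σ₀ : Perm ℤ} (H : Admissible n r σ₀)
    (H₁ : Admissible n r 1) :
    (restrictedD n r).val.map (fun σ => (relSorD n r σ σ₀, cyc0' n (σ * σ₀⁻¹))) =
      (restrictedD n r).val.map (fun σ => (invD n σ, prlminl' n σ)) :=
  map_eq_map_of_sum_eq _ _ _ (H.restricted_sum_sor_eq _ _ H₁)

/-! ### The case `σ₀ = 1`: sorting factorizations. -/

theorem flipOne_mul_signedSwap {l : ℤ} {k : ℕ} (hk : 2 ≤ k) :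
    flipOne * signedSwap (flipOne l) k = signedSwap l k * flipOne := by
  rw [conj_signedSwap (flipOne_mem_typeB le_rfl), ← Perm.mul_apply, flipOne_mul_self,
    flipOne_of_one_lt (by rw [abs_of_nonneg] <;> omega), Perm.one_apply]

/-- Position `1` has rank `k - 1`, and `2k - 2 - (k - 1) = k - 1`, so a letter in position `1` or
`-1` contributes the same. This absorbs the extra sign change in `(-j j)`. -/
theorem relSorAux_mul_flipOne {n : ℕ} (r : ℕ → ℕ) {k : ℕ} (hkn : k ≤ n) (σ : Perm ℤ) :
    relSorAux n r 1 k (σ * flipOne) = relSorAux n r 1 k σ := by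
  induction k generalizing σ with
  | zero => rfl
  | succ k ih =>
    rcases Nat.eq_zero_or_pos k with rfl | hk
    · rfl
    have h : (σ * flipOne)⁻¹ ((k + 1 : ℕ) : ℤ) = flipOne (σ⁻¹ ((k + 1 : ℕ) : ℤ)) := by
      rw [mul_inv_rev, flipOne_inv, Perm.mul_apply]
    rw [relSorAux_succ _ _ _ _ hk, relSorAux_succ _ _ _ _ hk, relSorTerm_eq, relSorTerm_eq, h,
      inv_one, Perm.one_apply, mul_assoc, flipOne_mul_signedSwap (by omega), ← mul_assoc,
      ih (by omega)]
    congr 1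
    have h1 := slotRank_one (r := r) (le_refl 1) (show 1 ≤ k + 1 by omega) hkn
    generalize σ⁻¹ ((k + 1 : ℕ) : ℤ) = l
    rw [flipOne_apply]
    by_cases e1 : l = -1
    · subst e1
      simp only [if_true, Int.natAbs_one, Int.natAbs_neg, h1]
      split_ifs <;> omega
    by_cases e2 : l = 1
    · subst e2
      rw [if_neg e1, if_pos rfl]
      simp only [Int.natAbs_one, Int.natAbs_neg, h1]
      split_ifs <;> omega
    rw [if_neg e1, if_neg e2]

theorem dTransposition_mem_typeB {N : ℕ} {i j : ℤ} (hj : 1 < j) (hjN : j ≤ N) (hi : i ≠ 0)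
    (hij : -j ≤ i) (hij' : i < j) : dTransposition i j ∈ typeB N := by
  unfold dTransposition
  split_ifs with h
  · refine typeB_mul (signedSwap_mem_typeB one_pos (by omega) (by omega) ?_)
      (signedSwap_mem_typeB (by omega) hjN (by omega) ?_) <;> rw [abs_le] <;> omega
  · exact signedSwap_mem_typeB (by omega) hjN hi (by rw [abs_le]; omega)

theorem dTransposition_apply_left {i j : ℤ} (hj : 1 < j) (hi : i ≠ 0) :
    dTransposition i j i = j := by
  unfold dTransposition
  split_ifs with h
  · rw [Perm.mul_apply, signedSwap_apply (x := i) (by omega) (by omega), ← h, if_pos rfl,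
      if_neg (by omega), signedSwap_apply one_pos (by omega)]
    split_ifs <;> omega
  · rw [signedSwap_apply (by omega) hi]
    split_ifs <;> omega

theorem signProd_dTransposition {N : ℕ} {i j : ℤ} (hj : 1 < j) (hjN : j ≤ N) (hi : i ≠ 0)
    (hij : -j ≤ i) (hij' : i < j) : signProd N (dTransposition i j) = 1 := by
  have hpos : ∀ i : ℤ, 0 < i → i < j → signProd N (signedSwap i j) = 1 := by
    intro i hi hij
    refine Finset.prod_eq_one fun k hk => Int.sign_eq_one_of_pos ?_
    rw [Finset.mem_Icc] at hk
    rw [signedSwap_apply (by omega) (by omega)]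
    split_ifs <;> omega
  have hflip : ∀ j : ℤ, 1 ≤ j → j ≤ N → signProd N (signedSwap (-j) j) = -1 := by
    intro j h1 h2
    have := signProd_flip (n := N) (j := j.toNat) (by omega) (by omega)
    rwa [Int.toNat_of_nonneg (by omega)] at this
  unfold dTransposition
  split_ifs with h
  · rw [signProd_mul (signedSwap_mem_typeB one_pos (by omega) (by omega) (by rw [abs_le]; omega))
      (signedSwap_mem_typeB (by omega) hjN (by omega) (by rw [abs_le]; omega)),
      hflip 1 le_rfl (by omega), hflip j (by omega) hjN]
    rfl
  rcases lt_or_gt_of_ne hi with h0 | h0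
  -- Conjugation by the sign change of `i` reduces a negative `i` to the positive case, and the sign
  -- of `f` cancels.
  · set f := signedSwap (- -i) (-i) with hf
    have hfB : f ∈ typeB N :=
      signedSwap_mem_typeB (by omega) (by omega) (by omega) (by rw [abs_le]; omega)
    have h1 : f (-i) = i := by
      rw [hf, signedSwap_apply (by omega) (by omega), if_pos rfl, neg_neg]
    have h2 : f j = j := by
      rw [hf, signedSwap_apply (by omega) (by omega)]
      split_ifs <;> omega
    have h3 := conj_signedSwap hfB (-i) j
    rw [h1, h2] at h3
    have h4 := congrArg (signProd N) h3
    rw [signProd_mul hfB (signedSwap_mem_typeB (by omega) hjN (by omega) (by rw [abs_le]; omega)),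
      signProd_mul (signedSwap_mem_typeB (by omega) hjN hi (by rw [abs_le]; omega)) hfB,
      hpos (-i) (by omega) (by omega), hf, hflip (-i) (by omega) (by omega)] at h4
    omega
  · exact hpos i h0 hij'

theorem IsSortingFactorization.mem_typeB {N : ℕ} {σ : Perm ℤ} {L : List (ℤ × ℤ)}
    (h : IsSortingFactorization N σ L) : σ ∈ typeB N ∧ signProd N σ = 1 := by
  obtain ⟨h1, -, rfl⟩ := h
  induction L with
  | nil => exact ⟨typeB_one N, signProd_one N⟩
  | cons p L ih =>
    obtain ⟨a1, a2, a3, a4, a5⟩ := h1 p (by simp)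
    have hp := dTransposition_mem_typeB a1 a2 a3 a4 a5
    have hL := ih fun p hp => h1 p (by simp [hp])
    rw [List.map_cons, List.prod_cons]
    exact ⟨typeB_mul hp hL.1, by
      rw [signProd_mul hp hL.1, hL.2, signProd_dTransposition a1 a2 a3 a4 a5, one_mul]⟩

/-- Only the last factor can involve `N + 1`. If it does not, `N + 1` is already in place and its
sorting step is trivial. If it does, the earlier factors fix `N + 1`, so `i` is its position and the
sorting step removes this factor up to `flipOne`. Hence every factorization has the same sum, and
the choice made in `sorD` is immaterial. -/
theorem IsSortingFactorization.sum_eq {n : ℕ} (r : ℕ → ℕ) {N : ℕ} (hN : N ≤ n) {σ : Perm ℤ}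
    {L : List (ℤ × ℤ)} (h : IsSortingFactorization N σ L) :
    (L.map (fun p => (p.2 - p.1 - (if p.1 < 0 then 2 else 0)).toNat)).sum =
      relSorAux n r 1 N σ := by
  induction N generalizing σ L with
  | zero =>
    rcases L with _ | ⟨p, L⟩
    · rfl
    · have := h.1 p (by simp)
      push_cast at this
      omega
  | succ N ih =>
    rcases Nat.eq_zero_or_pos N with rfl | hN0
    · rcases L with _ | ⟨p, L⟩
      · rfl
      · have := h.1 p (by simp)
        push_cast at this
        omega
    by_cases hlow : ∀ p ∈ L, p.2 ≤ (N : ℤ)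
    · have h' : IsSortingFactorization N σ L :=
        ⟨fun p hp => ⟨(h.1 p hp).1, hlow p hp, (h.1 p hp).2.2⟩, h.2⟩
      have hfix : σ⁻¹ ((N + 1 : ℕ) : ℤ) = (N + 1 : ℕ) :=
        (typeB_inv h'.mem_typeB.1).2 _ (by rw [abs_of_nonneg] <;> omega)
      rw [ih (by omega) h', relSorAux_succ _ _ _ _ hN0, relSorTerm_eq, hfix, inv_one,
        Perm.one_apply, if_pos (by omega), Int.natAbs_natCast, slotRank_one (by omega) le_rfl hN,
        Nat.sub_self, zero_add]
      congr 1
      unfold signedSwap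
      rw [if_neg (by omega), Equiv.swap_self, Equiv.swap_self, ← Perm.one_def, mul_one, mul_one]
    · rcases List.eq_nil_or_concat L with rfl | ⟨L', ⟨i, j⟩, rfl⟩
      · simp at hlow
      rw [List.concat_eq_append] at h hlow ⊢
      obtain ⟨h1, h2, h3⟩ := h
      rw [List.pairwise_append] at h2
      obtain ⟨a1, a2, a3, a4, a5⟩ := h1 (i, j) (by simp)
      simp only at a1 a2 a3 a4 a5
      have hlt : ∀ p ∈ L', p.2 < j := fun p hp => h2.2.2 p hp (i, j) (by simp)
      have hj : j = ((N + 1 : ℕ) : ℤ) := by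
        push Not at hlow
        obtain ⟨p, hp, hpN⟩ := hlow
        rw [List.mem_append, List.mem_singleton] at hp
        rcases hp with hp | rfl
        · have := hlt p hp
          omega
        · simp only at hpN
          omega
      set ρ := (L'.map (fun p => dTransposition p.1 p.2)).prod with hρ
      have h' : IsSortingFactorization N ρ L' := by
        refine ⟨fun p hp => ?_, h2.1, rfl⟩
        have := h1 p (by simp [hp])
        have := hlt p hp
        exact ⟨by tauto, by omega, by tauto⟩
      rw [List.map_append, List.prod_append, List.map_singleton, List.prod_singleton, ← hρ] at h3
      rw [List.map_append, List.sum_append, List.map_singleton, List.sum_singleton,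
        ih (by omega) h', add_comm, relSorAux_succ _ _ _ _ hN0, relSorTerm_eq, inv_one,
        Perm.one_apply]
      have hρK : ρ j = j := h'.mem_typeB.1.2 _ (by rw [abs_of_nonneg] <;> omega)
      have hl : σ⁻¹ ((N + 1 : ℕ) : ℤ) = i := by
        rw [Perm.inv_eq_iff_eq, ← h3, Perm.mul_apply, dTransposition_apply_left a1 a3, hρK, hj]
      rw [hl]
      congr 1
      -- The rank is `j - |i|`. For `i < 0` the contribution is `2j - 2 - (j + i) = j - i - 2`.
      · rw [slotRank_one (by omega) (by omega) hN]
        simp only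
        split_ifs <;> omega
      · rw [← h3, ← hj]
        unfold dTransposition
        simp only
        split_ifs with hij
        · rw [hij, mul_assoc, mul_assoc, signedSwap_mul_self (by omega) (by omega), mul_one,
            ← flipOne_eq, relSorAux_mul_flipOne r (by omega)]
        · rw [mul_assoc, signedSwap_mul_self (by omega) a3, mul_one]

theorem typeB_of_fixed {N : ℕ} {σ : Perm ℤ} (hσ : σ ∈ typeB (N + 1))
    (h : σ ((N + 1 : ℕ) : ℤ) = (N + 1 : ℕ)) : σ ∈ typeB N := by
  refine ⟨hσ.1, fun x hx => ?_⟩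
  by_cases hx' : ((N + 1 : ℕ) : ℤ) < |x|
  · exact hσ.2 x hx'
  · have h1 : |x| = ((N + 1 : ℕ) : ℤ) := by push_cast at hx' ⊢; omega
    rcases (abs_eq (by omega)).mp h1 with rfl | rfl
    · exact h
    · rw [hσ.1, h]

/-- Allowing the alternative `flipOne * σ` lets the induction ignore parity. For words of type D the
parity of signs rules the alternative out afterwards. -/
theorem exists_isSortingFactorization {N : ℕ} (hN : 1 ≤ N) {σ : Perm ℤ} (hσ : σ ∈ typeB N) :
    ∃ L, IsSortingFactorization N σ L ∨ IsSortingFactorization N (flipOne * σ) L := by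
  induction N, hN using Nat.le_induction generalizing σ with
  | base =>
    have h0 := typeB_zero hσ
    have h1 : σ 1 = 1 ∨ σ 1 = -1 := by
      have h2 : σ 1 ≠ 0 := typeB_ne_zero hσ one_ne_zero
      have h3 := abs_le.mp (typeB_abs_le hσ (x := 1) (by simp))
      push_cast at h3
      omega
    have h2 := hσ.1 1
    have hall : ∀ τ : Perm ℤ, τ ∈ typeB 1 → τ 1 = 1 → τ = 1 := by
      intro τ hτ h
      ext x
      by_cases hx : ((1 : ℕ) : ℤ) < |x|
      · exact hτ.2 x hx
      · have : x = 0 ∨ x = 1 ∨ x = -1 := by rw [lt_abs] at hx; omega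
        rw [Perm.one_apply]
        rcases this with rfl | rfl | rfl
        exacts [typeB_zero hτ, h, by rw [hτ.1, h]]
    refine ⟨[], h1.imp (fun h => ?_) (fun h => ?_)⟩
    · exact ⟨by simp, List.Pairwise.nil, (hall σ hσ h).symm⟩
    · refine ⟨by simp, List.Pairwise.nil,
        (hall _ (typeB_mul (flipOne_mem_typeB le_rfl) hσ) ?_).symm⟩
      rw [Perm.mul_apply, h, flipOne_apply, if_pos rfl]
  | succ N hN ih =>
    have hmono : ∀ {τ : Perm ℤ} {L}, IsSortingFactorization N τ L →
        IsSortingFactorization (N + 1) τ L := fun h =>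
      ⟨fun p hp => by have := h.1 p hp; push_cast; exact ⟨by tauto, by omega, by tauto⟩, h.2⟩
    obtain ⟨i, hi⟩ : ∃ i, i = σ⁻¹ ((N + 1 : ℕ) : ℤ) := ⟨_, rfl⟩
    have hi' : σ i = (N + 1 : ℕ) := by rw [hi, apply_inv_self]
    by_cases hiK : i = ((N + 1 : ℕ) : ℤ)
    · rw [hiK] at hi'
      obtain ⟨L, hL⟩ := ih (typeB_of_fixed hσ hi')
      exact ⟨L, hL.imp hmono hmono⟩
    have hi0 : i ≠ 0 := hi ▸ typeB_ne_zero (typeB_inv hσ) (by omega)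
    have hile : |i| ≤ ((N + 1 : ℕ) : ℤ) :=
      hi ▸ typeB_abs_le (typeB_inv hσ) (by rw [abs_of_nonneg] <;> omega)
    rw [abs_le] at hile
    have hT := dTransposition_mem_typeB (N := N + 1) (i := i) (j := ((N + 1 : ℕ) : ℤ)) (by omega)
      le_rfl hi0 hile.1 (by omega)
    have hTi := dTransposition_apply_left (i := i) (j := ((N + 1 : ℕ) : ℤ)) (by omega) hi0
    set T := dTransposition i ((N + 1 : ℕ) : ℤ) with hTdef
    obtain ⟨L, hL⟩ := ih (σ := σ * T⁻¹) (typeB_of_fixed (typeB_mul hσ (typeB_inv hT)) (by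
      rw [Perm.mul_apply, Perm.inv_eq_iff_eq.mpr hTi.symm, hi']))
    have hsnoc : ∀ {τ : Perm ℤ}, IsSortingFactorization N τ L →
        IsSortingFactorization (N + 1) (τ * T) (L ++ [(i, ((N + 1 : ℕ) : ℤ))]) := by
      intro τ h
      refine ⟨fun p hp => ?_, ?_, ?_⟩
      · rw [List.mem_append, List.mem_singleton] at hp
        rcases hp with hp | rfl
        · exact (hmono h).1 p hp
        · exact ⟨by simp only; omega, le_rfl, hi0, hile.1, by simp only; omega⟩
      · rw [List.pairwise_append]
        refine ⟨h.2.1, List.pairwise_singleton _ _, fun p hp p' hp' => ?_⟩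
        rw [List.mem_singleton] at hp'
        have := (h.1 p hp).2.1
        rw [hp']
        simp only
        omega
      · rw [List.map_append, List.prod_append, h.2.2, List.map_singleton, List.prod_singleton]
    refine ⟨L ++ [(i, ((N + 1 : ℕ) : ℤ))], hL.imp (fun h => ?_) (fun h => ?_)⟩
    · simpa using hsnoc h
    · simpa [mul_assoc] using hsnoc h

theorem relSorD_one_eq_sorD {n : ℕ} {r : ℕ → ℕ} {σ : Perm ℤ} (hσ : σ ∈ restrictedD n r) :
    relSorD n r σ 1 = sorD n σ := by
  have hex : ∃ L, IsSortingFactorization n σ L := by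
    rcases Nat.eq_zero_or_pos n with rfl | hn
    · rw [restrictedD_zero, Finset.mem_singleton] at hσ
      exact ⟨[], by simp, List.Pairwise.nil, hσ.symm⟩
    · rw [mem_restrictedD] at hσ
      obtain ⟨L, hL | hL⟩ := exists_isSortingFactorization hn hσ.1.1
      · exact ⟨L, hL⟩
      · have := hL.mem_typeB.2
        rw [signProd_mul (flipOne_mem_typeB hn) hσ.1.1, signProd_flipOne hn, hσ.2] at this
        omega
  unfold sorD
  rw [dif_pos hex, hex.choose_spec.sum_eq r le_rfl]
  rfl

end RestrictedD

theorem mainTheorem11 {R : Type*} [CommSemiring R] (q : R) (t s : ℕ → R)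
    (n : ℕ) (r : ℕ → ℕ)
    (hmono : ∀ i j : ℕ, 1 ≤ i → i ≤ j → j ≤ n → r i ≤ r j)
    (hr : ∀ k : ℕ, 1 ≤ k → k ≤ n → k ≤ r k ∧ r k ≤ n) :
    -- the generating function of `(inv_D, Prlminl')`
    (∑ σ ∈ RestrictedD.restrictedD n r,
        q ^ RestrictedD.invD n σ * ∏ i ∈ RestrictedD.prlminl' n σ, t i
      = ∏ i ∈ Finset.Icc 2 n,
          (t i + q * RestrictedD.qInt q (RestrictedD.riseHeight n r i - 1)
            + q ^ (2 * i - RestrictedD.riseHeight n r i - 1)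
              * RestrictedD.qInt q (RestrictedD.riseHeight n r i))) ∧
    -- the generating function of the sorting index relative to `σ₀`, and equidistribution
    (∀ σ₀ ∈ RestrictedD.restrictedD n r, (∀ k : ℕ, 1 ≤ k → k ≤ n → 0 < σ₀ (k : ℤ)) →
      (∑ σ ∈ RestrictedD.restrictedD n r,
          q ^ RestrictedD.relSorD n r σ σ₀
            * (∏ i ∈ RestrictedD.cyc0' n (σ * σ₀⁻¹), t i)
            * ∏ i ∈ RestrictedD.cyc1' n (σ * σ₀⁻¹), s i
        = ∏ i ∈ Finset.Icc 2 n,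
            (t i + (q + q ^ (2 * i - RestrictedD.riseHeight n r i - 1))
                * RestrictedD.qInt q (RestrictedD.riseHeight n r i - 1)
              + q ^ (2 * i - 2) * s i)) ∧
      (∑ σ ∈ RestrictedD.restrictedD n r,
          q ^ RestrictedD.relSorD n r σ σ₀ * ∏ i ∈ RestrictedD.cyc0' n (σ * σ₀⁻¹), t i
        = ∑ σ ∈ RestrictedD.restrictedD n r,
          q ^ RestrictedD.invD n σ * ∏ i ∈ RestrictedD.prlminl' n σ, t i) ∧
      (RestrictedD.restrictedD n r).val.map
          (fun σ => (RestrictedD.relSorD n r σ σ₀, RestrictedD.cyc0' n (σ * σ₀⁻¹)))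
        = (RestrictedD.restrictedD n r).val.map
          (fun σ => (RestrictedD.invD n σ, RestrictedD.prlminl' n σ))) ∧
    -- the case `σ₀ = id`, where the relative sorting index is `sor_D`
    (∀ σ ∈ RestrictedD.restrictedD n r,
      RestrictedD.relSorD n r σ 1 = RestrictedD.sorD n σ) ∧
    (∑ σ ∈ RestrictedD.restrictedD n r,
        q ^ RestrictedD.sorD n σ * (∏ i ∈ RestrictedD.cyc0' n σ, t i)
          * ∏ i ∈ RestrictedD.cyc1' n σ, s i
      = ∏ i ∈ Finset.Icc 2 n,
          (t i + (q + q ^ (2 * i - RestrictedD.riseHeight n r i - 1))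
              * RestrictedD.qInt q (RestrictedD.riseHeight n r i - 1)
            + q ^ (2 * i - 2) * s i)) ∧
    (∑ σ ∈ RestrictedD.restrictedD n r,
        q ^ RestrictedD.sorD n σ * ∏ i ∈ RestrictedD.cyc0' n σ, t i
      = ∑ σ ∈ RestrictedD.restrictedD n r,
        q ^ RestrictedD.invD n σ * ∏ i ∈ RestrictedD.prlminl' n σ, t i) ∧
    (RestrictedD.restrictedD n r).val.map
        (fun σ => (RestrictedD.sorD n σ, RestrictedD.cyc0' n σ))
      = (RestrictedD.restrictedD n r).val.map
        (fun σ => (RestrictedD.invD n σ, RestrictedD.prlminl' n σ)) := by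
  have H₁ : RestrictedD.Admissible n r 1 :=
    RestrictedD.admissible_one hmono fun k h1 h2 => (hr k h1 h2).1
  have hone : ∀ σ : Equiv.Perm ℤ, σ * (1 : Equiv.Perm ℤ)⁻¹ = σ := fun σ => by
    rw [inv_one, mul_one]
  have hsor : ∀ σ ∈ RestrictedD.restrictedD n r,
      RestrictedD.relSorD n r σ 1 = RestrictedD.sorD n σ :=
    fun σ hσ => RestrictedD.relSorD_one_eq_sorD hσ
  have h1 := H₁.restricted_sum_sor q t s
  have h2 := H₁.restricted_sum_sor_eq q t H₁
  have h3 := H₁.map_sor_eq_map_inv H₁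
  simp only [hone] at h1 h2 h3
  refine ⟨RestrictedD.restricted_sum_inv q t H₁, fun σ₀ hσ₀ hpos => ?_, hsor, ?_, ?_, ?_⟩
  · rw [RestrictedD.mem_restrictedD] at hσ₀
    have H : RestrictedD.Admissible n r σ₀ := ⟨hmono, hσ₀.1.1, hpos, hσ₀.1.2⟩
    exact ⟨H.restricted_sum_sor q t s, H.restricted_sum_sor_eq q t H₁, H.map_sor_eq_map_inv H₁⟩
  · rw [← h1]
    exact Finset.sum_congr rfl fun σ hσ => by rw [hsor σ hσ]
  · rw [← h2]
    exact Finset.sum_congr rfl fun σ hσ => by rw [hsor σ hσ]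
  · rw [← h3]
    exact Multiset.map_congr rfl fun σ hσ => by rw [hsor σ (Finset.mem_val.mp hσ)]
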